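/- Let $\mathbb F$ be a field of characteristic $p>3$, let $n\ge 3$, and let $\underline t=(t_1,\dots,t_n)$ be an $n$-tuple of positive integers. Put $Y_0=\{1,\dots,n\}$, $Y_1=\{n+1,\dots,2n\}$, $Y=Y_0\cup Y_1$, let $\mu(i)=0$ for $i\in Y_0$ and $\mu(i)=1$ for $i\in Y_1$, and let $i'=i+n$ for $i\in Y_0$ and $i'=i-n$ for $i\in Y_1$. Let $\mathcal O(n,n)=\mathcal O(n)\otimes\Lambda(n)$ be the tensor product of the divided power algebra $\mathcal O(n)$ over $\mathbb F$, with basis $x^{(\alpha)}$ $(\alpha\in\mathbb Z_{\ge0}^n)$ and product $x^{(\alpha)}x^{(\beta)}=\binom{\alpha+\beta}{\alpha}x^{(\alpha+\beta)}$, and the exterior algebra $\Lambda(n)$ in the odd variables $x_{n+1},\dots,x_{2n}$; write $\mathrm p(a)\in\mathbb Z/2$ for the parity of a homogeneous $a$. Let $\partial_r$ $(r\in Y)$ be the superderivations of $\mathcal O(n,n)$ with $\partial_r(x^{(\alpha)}x^u)=x^{(\alpha-\varepsilon_r)}x^u$ (zero if $\alpha_r=0$) for $r\in Y_0$, and $\partial_r(x^{(\alpha)}x^u)=x^{(\alpha)}\,\partial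 x^u/\partial x_r$ (left derivative) for $r\in Y_1$, where $x^u$ runs through the ordered products of distinct odd variables. Let $\mathcal O(n,n;\underline t)$ be the span of the $x^{(\alpha)}x^u$ with $0\le\alpha_i\le p^{t_i}-1$ for all $i\in Y_0$. Define the linear map $\mathrm{T_H}$ from $\mathcal O(n,n;\underline t)$ to the superderivations of $\mathcal O(n,n)$ by $$\mathrm{T_H}(a)=\sum_{i=1}^{2n}(-1)^{\mu(i)\mathrm p(a)}\partial_i(a)\,\partial_{i'}\qquad(a\ \text{homogeneous}),$$ let $HO(n,n;\underline t)=\{\mathrm{T_H}(a)\mid a\in\mathcal O(n,n;\underline t)\}$ be the odd Hamiltonian superalgebra, and let $\mathcal{HO}$ be its even part, a Lie algebra under the commutator. Put $\Gamma=\sum_{i=1}^n x_{i'}\partial_{i'}$. Then, as vector spaces of linear maps on $\mathcal{HO}$, $$\mathrm{Der}(\mathcal{HO})=\mathrm{ad}(\mathcal{HO}+\mathbb F\,\Gamma)\ \oplus\ \mathrm{span}_{\mathbb F}\{(\mathrm{ad}\,\partial_i)^{p^{k}}\mid i\in Y_0,\ 1\le k<t_i\},$$ where $\mathrm{Der}(\mathcal{HO})$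 is the space of all derivations of the Lie algebra $\mathcal{HO}$ and $\mathrm{ad}\,D$ denotes the map $E\mapsto[D,E]$ on $\mathcal{HO}$. In particular the maps on the right send $\mathcal{HO}$ into itself. -/

import Mathlib

namespace OddHamiltonian

/-- The superalgebra `𝒪(n,n) = 𝒪(n) ⊗ Λ(n)`, given by its basis: the index `(α, u)` stands for
`x^(α) x^u`, where `x^(α)` is a divided power monomial in `x_1, …, x_n` and `x^u` is the product, in
increasing order, of the odd variables `x_{i'}` with `i ∈ u` (`i' = n + i`). -/
abbrev O (F : Type*) [Field F] (n : ℕ) : Type _ := ((Fin n → ℕ) × Finset (Fin n)) →₀ F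

/-- The index set `Y = Y₀ ∪ Y₁`; `Sum.inl i` is `i ∈ Y₀` and `Sum.inr i` is `i' ∈ Y₁`. -/
abbrev Y (n : ℕ) : Type := Fin n ⊕ Fin n

section

variable {F : Type*} [Field F] {n : ℕ}

attribute [local instance] LieRing.ofAssociativeRing

/-- The basis element `x^(α) x^u`. -/
noncomputable def mono (α : Fin n → ℕ) (u : Finset (Fin n)) : O F n := Finsupp.single (α, u) 1

/-- `(-1)` to the number of pairs `(i, j) ∈ u × v` with `j < i`: for disjoint `u`, `v` this is
the sign in `x^u x^v = ± x^(u ∪ v)`. -/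
def sgn (F : Type*) [Field F] (u v : Finset (Fin n)) : F :=
  ∏ i ∈ u, ∏ j ∈ v, if j < i then -1 else 1

/-- `∏ i, binom (α_i + β_i) α_i`. -/
def binom (α β : Fin n → ℕ) : ℕ := ∏ i, (α i + β i).choose (α i)

/-- The multiplication of `𝒪(n,n)`. -/
noncomputable def mul : O F n →ₗ[F] O F n →ₗ[F] O F n :=
  Finsupp.linearCombination F fun a : (Fin n → ℕ) × Finset (Fin n) =>
    Finsupp.linearCombination F fun b : (Fin n → ℕ) × Finset (Fin n) =>
      if Disjoint a.2 b.2 then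
        (sgn F a.2 b.2 * (binom a.1 b.1 : F)) • mono (a.1 + b.1) (a.2 ∪ b.2)
      else 0

/-- The superderivations `∂_r`, `r ∈ Y`, of `𝒪(n,n)`; for `r ∈ Y₁` it is the left derivative, so
moving `x_r` to the front of `x^u` gives a sign. -/
noncomputable def del : Y n → Module.End F (O F n)
  | .inl i => Finsupp.linearCombination F fun a : (Fin n → ℕ) × Finset (Fin n) =>
      if a.1 i = 0 then 0 else mono (a.1 - Pi.single i 1) a.2
  | .inr i => Finsupp.linearCombination F fun a : (Fin n → ℕ) × Finset (Fin n) =>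
      if i ∈ a.2 then sgn F {i} a.2 • mono a.1 (a.2.erase i) else 0

/-- The parity `μ` on `Y`, as a natural number. -/
def mu : Y n → ℕ
  | .inl _ => 0
  | .inr _ => 1

/-- The homogeneous components of `𝒪(n,n)` for its `ℤ/2`-gradation. -/
noncomputable def parityPart (F : Type*) [Field F] (n : ℕ) (j : ZMod 2) : Submodule F (O F n) :=
  Finsupp.supported F F {a : (Fin n → ℕ) × Finset (Fin n) | ((a.2.card : ℕ) : ZMod 2) = j}

/-- The linear map `a ↦ (-1)^{p(a)} a`, for homogeneous `a`. -/
noncomputable def parityInv : Module.End F (O F n) :=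
  Finsupp.linearCombination F fun a : (Fin n → ℕ) × Finset (Fin n) =>
    ((-1 : F) ^ a.2.card) • mono a.1 a.2

/-- `T_H(a) = ∑_{i ∈ Y} (-1)^{μ(i) p(a)} ∂_i(a) ∂_{i'}`, as an operator on `𝒪(n,n)`. -/
noncomputable def TH : O F n →ₗ[F] Module.End F (O F n) :=
  ∑ i : Y n, (LinearMap.mulRight F (del (F := F) i.swap)) ∘ₗ
    (mul : O F n →ₗ[F] Module.End F (O F n)) ∘ₗ del i ∘ₗ (parityInv ^ mu i)

/-- `𝒪(n,n;t)`, spanned by the `x^(α) x^u` with `α_i ≤ p^{t_i} - 1`. -/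
noncomputable def OT (F : Type*) [Field F] (p : ℕ) {n : ℕ} (t : Fin n → ℕ) :
    Submodule F (O F n) :=
  Finsupp.supported F F {a : (Fin n → ℕ) × Finset (Fin n) | ∀ i, a.1 i < p ^ t i}

/-- The odd Hamiltonian superalgebra `HO(n,n;t)` as a space of operators on `𝒪(n,n)`. -/
noncomputable def HO (F : Type*) [Field F] (p : ℕ) {n : ℕ} (t : Fin n → ℕ) :
    Submodule F (Module.End F (O F n)) :=
  (OT F p t).map TH

/-- The even operators on `𝒪(n,n)`: those that preserve the parity. -/
noncomputable def evenEnd (F : Type*) [Field F] (n : ℕ) : Submodule F (Module.End F (O F n)) where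
  carrier := {D | ∀ j, ∀ f ∈ parityPart F n j, D f ∈ parityPart F n j}
  add_mem' h₁ h₂ j f hf := add_mem (h₁ j f hf) (h₂ j f hf)
  zero_mem' j _ _ := zero_mem (parityPart F n j)
  smul_mem' c _ h j f hf := (parityPart F n j).smul_mem c (h j f hf)

/-- `Γ = ∑_i x_{i'} ∂_{i'}`. -/
noncomputable def Gam (F : Type*) [Field F] (n : ℕ) : Module.End F (O F n) :=
  ∑ i : Fin n, mul (mono 0 {i}) * del (.inr i)

/-! ### The even part of `HO(n,n;t)` is closed under the commutator -/

lemma mul_mono (α β : Fin n → ℕ) (u v : Finset (Fin n)) :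
    mul (mono α u : O F n) (mono β v) =
      if Disjoint u v then (sgn F u v * (binom α β : F)) • mono (α + β) (u ∪ v) else 0 := by
  simp [mul, mono]

lemma del_inl_mono (i : Fin n) (α : Fin n → ℕ) (u : Finset (Fin n)) :
    del (.inl i) (mono α u : O F n) = if α i = 0 then 0 else mono (α - Pi.single i 1) u := by
  simp [del, mono]

lemma del_inr_mono (i : Fin n) (α : Fin n → ℕ) (u : Finset (Fin n)) :
    del (.inr i) (mono α u : O F n) =
      if i ∈ u then sgn F {i} u • mono α (u.erase i) else 0 := by
  simp [del, mono]

lemma parityInv_mono (α : Fin n → ℕ) (u : Finset (Fin n)) :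
    parityInv (mono α u : O F n) = ((-1 : F) ^ u.card) • mono α u := by
  simp [parityInv, mono]

lemma ext_mono {M : Type*} [AddCommGroup M] [Module F M] {f g : O F n →ₗ[F] M}
    (h : ∀ α u, f (mono α u) = g (mono α u)) : f = g := by
  apply Finsupp.lhom_ext'
  rintro ⟨α, u⟩
  ext
  exact h α u

lemma sgn_union_left {u v w : Finset (Fin n)} (h : Disjoint u v) :
    sgn F (u ∪ v) w = sgn F u w * sgn F v w := Finset.prod_union h

lemma sgn_union_right {u v w : Finset (Fin n)} (h : Disjoint v w) :
    sgn F u (v ∪ w) = sgn F u v * sgn F u w := by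
  simp [sgn, Finset.prod_union h, Finset.prod_mul_distrib]

lemma sgn_comm {u v : Finset (Fin n)} (h : Disjoint u v) :
    sgn F u v = (-1) ^ (u.card * v.card) * sgn F v u := by
  have h2 : sgn F v u = ∏ i ∈ u, ∏ j ∈ v, if i < j then (-1 : F) else 1 := by
    rw [sgn, Finset.prod_comm]
  have h3 : ((-1 : F)) ^ (u.card * v.card) = ∏ i ∈ u, ∏ j ∈ v, (-1 : F) := by
    simp [← pow_mul, mul_comm]
  rw [h2, h3, sgn, ← Finset.prod_mul_distrib]
  refine Finset.prod_congr rfl fun i hi => ?_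
  rw [← Finset.prod_mul_distrib]
  refine Finset.prod_congr rfl fun j hj => ?_
  have : i ≠ j := fun e => Finset.disjoint_left.1 h hi (e ▸ hj)
  rcases lt_or_gt_of_ne this with h | h
  · simp [h, not_lt.2 h.le]
  · simp [h, not_lt.2 h.le]

lemma sgn_mul_self (u v : Finset (Fin n)) : sgn F u v * sgn F u v = 1 := by
  simp only [sgn, ← Finset.prod_mul_distrib]
  refine Finset.prod_eq_one fun i _ => Finset.prod_eq_one fun j _ => ?_
  split_ifs <;> simp

lemma binom_comm (α β : Fin n → ℕ) : binom α β = binom β α := by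
  refine Finset.prod_congr rfl fun i _ => ?_
  rw [add_comm, ← Nat.choose_symm_add]

lemma binom_assoc (α β γ : Fin n → ℕ) :
    binom α β * binom (α + β) γ = binom β γ * binom α (β + γ) := by
  simp only [binom, ← Finset.prod_mul_distrib]
  refine Finset.prod_congr rfl fun i _ => ?_
  have h1 := Nat.add_choose_mul_factorial_mul_factorial (α i) (β i)
  have h2 := Nat.add_choose_mul_factorial_mul_factorial (α i + β i) (γ i)
  have h3 := Nat.add_choose_mul_factorial_mul_factorial (β i) (γ i)
  have h4 := Nat.add_choose_mul_factorial_mul_factorial (α i) (β i + γ i)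
  simp only [Pi.add_apply]
  have e : (α i).factorial * (β i).factorial * (γ i).factorial ≠ 0 := by positivity
  apply Nat.eq_of_mul_eq_mul_right (Nat.pos_of_ne_zero e)
  rw [← Nat.choose_symm_add] at h1 h2 h3 h4
  calc _ = (α i + β i + γ i).choose (α i + β i) *
        ((α i + β i).choose (α i) * (α i).factorial * (β i).factorial) * (γ i).factorial := by ring
    _ = (α i + (β i + γ i)).choose (α i) * (α i).factorial *
        ((β i + γ i).choose (β i) * (β i).factorial * (γ i).factorial) := by
        rw [h1, h2, h3, h4, add_assoc]
    _ = _ := by ring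

lemma mul_assoc' (f g h : O F n) : mul (mul f g) h = mul f (mul g h) := by
  have key : (mul : O F n →ₗ[F] _).compr₂ (mul : O F n →ₗ[F] O F n →ₗ[F] O F n) =
      (((LinearMap.llcomp F (O F n) (O F n) (O F n)).flip ∘ₗ mul).flip ∘ₗ mul) := by
    refine ext_mono fun α u => ext_mono fun β v => ext_mono fun γ w => ?_
    change mul (mul (mono α u) (mono β v)) (mono γ w) =
      mul (mono α u) (mul (mono β v) (mono γ w))
    rw [mul_mono, mul_mono]
    by_cases huv : Disjoint u v <;> by_cases hvw : Disjoint v w <;>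
      by_cases huw : Disjoint u w <;>
      simp [huv, hvw, huw, mul_mono, Finset.disjoint_union_left, Finset.disjoint_union_right]
    rw [sgn_union_left huv, sgn_union_right hvw, smul_smul, smul_smul, add_assoc]
    congr 1
    have := congrArg (Nat.cast (R := F)) (binom_assoc α β γ)
    push_cast at this
    linear_combination (sgn F u v * sgn F u w * sgn F v w) * this
  exact LinearMap.congr_fun (LinearMap.congr_fun (LinearMap.congr_fun key f) g) h

lemma mem_parityPart_mono {α : Fin n → ℕ} {u : Finset (Fin n)} {j : ZMod 2}
    (h : ((u.card : ℕ) : ZMod 2) = j) : (mono α u : O F n) ∈ parityPart F n j :=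
  Finsupp.single_mem_supported F 1 h

lemma mem_OT_mono {p : ℕ} {t : Fin n → ℕ} {α : Fin n → ℕ} {u : Finset (Fin n)}
    (h : ∀ i, α i < p ^ t i) : (mono α u : O F n) ∈ OT F p t :=
  Finsupp.single_mem_supported F 1 h

lemma parityPart_induction {j : ZMod 2} {P : Submodule F (O F n)}
    (h : ∀ α u, ((u.card : ℕ) : ZMod 2) = j → mono α u ∈ P) : parityPart F n j ≤ P := by
  rw [parityPart, Finsupp.supported_eq_span_single, Submodule.span_le]
  rintro _ ⟨⟨α, u⟩, hu, rfl⟩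
  exact h α u hu

lemma OT_induction {p : ℕ} {t : Fin n → ℕ} {P : Submodule F (O F n)}
    (h : ∀ α u, (∀ i, α i < p ^ t i) → mono α u ∈ P) : OT F p t ≤ P := by
  rw [OT, Finsupp.supported_eq_span_single, Submodule.span_le]
  rintro _ ⟨⟨α, u⟩, hu, rfl⟩
  exact h α u hu

lemma neg_one_pow_of_cast {k : ℕ} {j : ZMod 2} (h : (k : ZMod 2) = j) :
    (-1 : F) ^ k = (-1) ^ j.val := by
  subst h
  rw [ZMod.val_natCast]
  exact neg_one_pow_eq_pow_mod_two k

lemma parityInv_apply {j : ZMod 2} {f : O F n} (hf : f ∈ parityPart F n j) :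
    parityInv f = ((-1 : F) ^ j.val) • f := by
  have : parityPart F n j ≤ LinearMap.eqLocus parityInv (((-1 : F) ^ j.val) • LinearMap.id) := by
    refine parityPart_induction fun α u h => ?_
    rw [LinearMap.mem_eqLocus, parityInv_mono, neg_one_pow_of_cast h]
    rfl
  exact this hf

lemma mul_mono_comm (α β : Fin n → ℕ) (u v : Finset (Fin n)) :
    mul (mono α u : O F n) (mono β v) =
      ((-1 : F) ^ (u.card * v.card)) • mul (mono β v) (mono α u) := by
  rw [mul_mono, mul_mono]
  by_cases h : Disjoint u v
  · rw [if_pos h, if_pos h.symm, sgn_comm h, binom_comm, add_comm, Finset.union_comm, smul_smul,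
      mul_assoc]
  · rw [if_neg h, if_neg fun h' => h h'.symm, smul_zero]

lemma mul_comm_parity {i j : ZMod 2} {f g : O F n} (hf : f ∈ parityPart F n i)
    (hg : g ∈ parityPart F n j) : mul f g = ((-1 : F) ^ (i.val * j.val)) • mul g f := by
  have h1 : ∀ α u, ((u.card : ℕ) : ZMod 2) = i → ∀ g ∈ parityPart F n j,
      mul (mono α u : O F n) g = ((-1 : F) ^ (i.val * j.val)) • mul g (mono α u) := by
    intro α u hu g hg
    have : parityPart F n j ≤ LinearMap.eqLocus (mul (mono α u : O F n))
        (((-1 : F) ^ (i.val * j.val)) • mul.flip (mono α u)) := by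
      refine parityPart_induction fun β v hv => ?_
      have e : (-1 : F) ^ (u.card * v.card) = (-1) ^ (i.val * j.val) := by
        rw [pow_mul, neg_one_pow_of_cast hu, ← pow_mul, mul_comm, pow_mul,
          neg_one_pow_of_cast hv, ← pow_mul, mul_comm]
      rw [LinearMap.mem_eqLocus, mul_mono_comm, e]
      rfl
    exact this hg
  have : parityPart F n i ≤ LinearMap.eqLocus (mul.flip g)
      (((-1 : F) ^ (i.val * j.val)) • mul g) :=
    parityPart_induction fun α u hu => h1 α u hu g hg
  exact this hf

lemma mul_mem_parityPart {i j : ZMod 2} {f g : O F n} (hf : f ∈ parityPart F n i)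
    (hg : g ∈ parityPart F n j) : mul f g ∈ parityPart F n (i + j) := by
  have : parityPart F n i ≤ (parityPart F n (i + j)).comap (mul.flip g) := by
    refine parityPart_induction fun α u hu => ?_
    have : parityPart F n j ≤ (parityPart F n (i + j)).comap (mul (mono α u)) := by
      refine parityPart_induction fun β v hv => ?_
      rw [Submodule.mem_comap, mul_mono]
      split_ifs with h
      · refine Submodule.smul_mem _ _ (mem_parityPart_mono ?_)
        rw [Finset.card_union_of_disjoint h, Nat.cast_add, hu, hv]
      · exact zero_mem _
    exact this hg
  exact this hf

lemma del_inl_mem_parityPart (i : Fin n) {j : ZMod 2} {f : O F n} (hf : f ∈ parityPart F n j) :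
    del (.inl i) f ∈ parityPart F n j := by
  have : parityPart F n j ≤ (parityPart F n j).comap (del (.inl i)) := by
    refine parityPart_induction fun α u hu => ?_
    rw [Submodule.mem_comap, del_inl_mono]
    split_ifs
    · exact zero_mem _
    · exact mem_parityPart_mono hu
  exact this hf

lemma del_inr_mem_parityPart (i : Fin n) {j : ZMod 2} {f : O F n} (hf : f ∈ parityPart F n j) :
    del (.inr i) f ∈ parityPart F n (j + 1) := by
  have : parityPart F n j ≤ (parityPart F n (j + 1)).comap (del (.inr i)) := by
    refine parityPart_induction fun α u hu => ?_
    rw [Submodule.mem_comap, del_inr_mono]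
    split_ifs with h
    · refine Submodule.smul_mem _ _ (mem_parityPart_mono ?_)
      have := Finset.card_erase_add_one h
      rw [← hu, ← this]
      push_cast
      rw [add_assoc, CharTwo.add_self_eq_zero, add_zero]
    · exact zero_mem _
  exact this hf

lemma del_mem_OT {p : ℕ} {t : Fin n → ℕ} (r : Y n) {f : O F n} (hf : f ∈ OT F p t) :
    del r f ∈ OT F p t := by
  have : OT F p t ≤ (OT F p t).comap (del r) := by
    refine OT_induction fun α u hu => ?_
    rw [Submodule.mem_comap]
    rcases r with i | i
    · rw [del_inl_mono]
      split_ifs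
      · exact zero_mem _
      · exact mem_OT_mono fun k => lt_of_le_of_lt (Nat.sub_le _ _) (hu k)
    · rw [del_inr_mono]
      split_ifs
      · exact Submodule.smul_mem _ _ (mem_OT_mono hu)
      · exact zero_mem _
  exact this hf

lemma dvd_choose_of_carry {p : ℕ} (hp : p.Prime) {a b k : ℕ} (ha : a < p ^ k) (hb : b < p ^ k)
    (h : p ^ k ≤ a + b) : p ∣ (a + b).choose a := by
  have hpos : (a + b).choose a ≠ 0 := (Nat.choose_pos (Nat.le_add_right a b)).ne'
  rw [hp.dvd_iff_one_le_factorization hpos, Nat.choose_symm_add, Nat.factorization_choose' hp (Nat.lt_succ_self _),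
    Finset.one_le_card]
  refine ⟨k, ?_⟩
  have hk : k ≠ 0 := by
    rintro rfl
    simp only [pow_zero] at ha hb h
    omega
  simp only [Finset.mem_filter, Finset.mem_Ico]
  refine ⟨⟨Nat.one_le_iff_ne_zero.2 hk, ?_⟩, ?_⟩
  · exact Nat.lt_succ_of_le (Nat.le_log_of_pow_le hp.one_lt (by omega))
  · rw [Nat.mod_eq_of_lt ha, Nat.mod_eq_of_lt hb]
    omega

lemma mul_mem_OT {p : ℕ} [hp : Fact p.Prime] [CharP F p] {t : Fin n → ℕ} {f g : O F n}
    (hf : f ∈ OT F p t) (hg : g ∈ OT F p t) : mul f g ∈ OT F p t := by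
  have : OT F p t ≤ (OT F p t).comap (mul.flip g) := by
    refine OT_induction fun α u hu => ?_
    have : OT F p t ≤ (OT F p t).comap (mul (mono α u)) := by
      refine OT_induction fun β v hv => ?_
      rw [Submodule.mem_comap, mul_mono]
      split_ifs with h
      · by_cases hc : ∀ i, α i + β i < p ^ t i
        · exact Submodule.smul_mem _ _ (mem_OT_mono hc)
        · push Not at hc
          obtain ⟨i, hi⟩ := hc
          have h0 : (binom α β : F) = 0 := by
            rw [CharP.cast_eq_zero_iff F p]
            exact (dvd_choose_of_carry hp.out (hu i) (hv i) hi).trans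
              (Finset.dvd_prod_of_mem _ (Finset.mem_univ i))
          rw [h0, mul_zero, zero_smul]
          exact zero_mem _
      · exact zero_mem _
    exact this hg
  exact this hf

lemma binom_pascal (i : Fin n) (α β : Fin n → ℕ) :
    binom (α + Pi.single i 1) (β + Pi.single i 1) =
      binom α (β + Pi.single i 1) + binom (α + Pi.single i 1) β := by
  simp only [binom, ← Finset.mul_prod_erase Finset.univ _ (Finset.mem_univ i)]
  have e : ∀ α' β' : Fin n → ℕ, (∀ j, j ≠ i → α' j = α j) → (∀ j, j ≠ i → β' j = β j) →
      ∏ j ∈ Finset.univ.erase i, (α' j + β' j).choose (α' j) =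
        ∏ j ∈ Finset.univ.erase i, (α j + β j).choose (α j) := by
    intro α' β' h1 h2
    refine Finset.prod_congr rfl fun j hj => ?_
    rw [h1 j (Finset.ne_of_mem_erase hj), h2 j (Finset.ne_of_mem_erase hj)]
  have ea : ∀ j, j ≠ i → (α + Pi.single i 1 : Fin n → ℕ) j = α j := fun j hj => by
    simp [hj]
  have eb : ∀ j, j ≠ i → (β + Pi.single i 1 : Fin n → ℕ) j = β j := fun j hj => by simp [hj]
  rw [e _ _ ea eb, e _ _ (fun _ _ => rfl) eb, e _ _ ea (fun _ _ => rfl), ← add_mul]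
  congr 1
  simp only [Pi.add_apply, Pi.single_eq_same]
  rw [show α i + 1 + (β i + 1) = (α i + (β i + 1)) + 1 by ring, Nat.choose_succ_succ,
    show α i + 1 + β i = α i + (β i + 1) by ring]

lemma binom_right_of_zero (i : Fin n) (α β : Fin n → ℕ) (h : α i = 0) :
    binom α (β + Pi.single i 1) = binom α β := by
  refine Finset.prod_congr rfl fun j _ => ?_
  by_cases hj : j = i
  · subst hj
    simp [h]
  · simp [hj]

lemma exists_add_single {i : Fin n} {α : Fin n → ℕ} (h : α i ≠ 0) :
    ∃ α' : Fin n → ℕ, α = α' + Pi.single i 1 := by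
  refine ⟨α - Pi.single i 1, funext fun j => ?_⟩
  by_cases hj : j = i
  · subst hj
    simp
    omega
  · simp [hj]

lemma del_inl_mul (i : Fin n) (f g : O F n) :
    del (.inl i) (mul f g) = mul (del (.inl i) f) g + mul f (del (.inl i) g) := by
  have key : (mul : O F n →ₗ[F] O F n →ₗ[F] O F n).compr₂ (del (.inl i)) =
      (mul ∘ₗ del (.inl i)) + (mul.compl₂ (del (.inl i))) := by
    refine ext_mono fun α u => ext_mono fun β v => ?_
    change del (.inl i) (mul (mono α u : O F n) (mono β v)) =
      mul (del (.inl i) (mono α u)) (mono β v) + mul (mono α u) (del (.inl i) (mono β v))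
    have hs : ∀ γ : Fin n → ℕ, γ + Pi.single i 1 - Pi.single i 1 = γ := fun γ => by
      funext j
      simp
    have hn : ∀ γ : Fin n → ℕ, (γ + Pi.single i 1 : Fin n → ℕ) i ≠ 0 := fun γ => by simp
    rw [mul_mono, del_inl_mono, del_inl_mono]
    by_cases huv : Disjoint u v
    swap
    · rw [if_neg huv]
      split_ifs <;> simp [mul_mono, huv]
    rw [if_pos huv, map_smul, del_inl_mono]
    by_cases ha : α i = 0 <;> by_cases hb : β i = 0
    · simp [ha, hb]
    · obtain ⟨β, rfl⟩ := exists_add_single hb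
      rw [if_pos ha, if_neg hb, hs, ← add_assoc, if_neg (hn _), hs, mul_mono, if_pos huv,
        binom_right_of_zero i α β ha]
      simp
    · obtain ⟨α, rfl⟩ := exists_add_single ha
      rw [if_neg ha, if_pos hb, hs, add_right_comm, if_neg (hn _), hs, mul_mono, if_pos huv,
        binom_comm, binom_right_of_zero i β α hb, binom_comm]
      simp
    · obtain ⟨α, rfl⟩ := exists_add_single ha
      obtain ⟨β, rfl⟩ := exists_add_single hb
      rw [if_neg ha, if_neg hb, hs, hs, ← add_assoc, if_neg (hn _), hs, mul_mono, mul_mono,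
        if_pos huv, if_pos huv, binom_pascal, ← add_assoc, add_right_comm α _ β, ← add_smul]
      congr 1
      push_cast
      ring
  exact LinearMap.congr_fun (LinearMap.congr_fun key f) g

lemma sgn_singleton_erase (i : Fin n) (u : Finset (Fin n)) :
    sgn F {i} (u.erase i) = sgn F {i} u := by
  by_cases h : i ∈ u
  · simp [sgn, ← Finset.mul_prod_erase u _ h]
  · rw [Finset.erase_eq_of_notMem h]

lemma sgn_split_left {i : Fin n} {u : Finset (Fin n)} (h : i ∈ u) (v : Finset (Fin n)) :
    sgn F u v = sgn F {i} v * sgn F (u.erase i) v := by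
  simp [sgn, ← Finset.mul_prod_erase u _ h]

lemma sgn_split_right {i : Fin n} {v : Finset (Fin n)} (h : i ∈ v) (u : Finset (Fin n)) :
    sgn F u v = sgn F u {i} * sgn F u (v.erase i) := by
  simp only [sgn, ← Finset.mul_prod_erase v _ h, Finset.prod_mul_distrib, Finset.prod_singleton]

lemma sgn_swap_singleton {i : Fin n} {u : Finset (Fin n)} (h : i ∉ u) :
    sgn F u {i} = (-1) ^ u.card * sgn F {i} u := by
  rw [sgn_comm (by simpa using h)]
  simp

lemma del_inr_mul (i : Fin n) (f g : O F n) :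
    del (.inr i) (mul f g) = mul (del (.inr i) f) g + mul (parityInv f) (del (.inr i) g) := by
  have key : (mul : O F n →ₗ[F] O F n →ₗ[F] O F n).compr₂ (del (.inr i)) =
      (mul ∘ₗ del (.inr i)) + ((mul ∘ₗ parityInv).compl₂ (del (.inr i))) := by
    refine ext_mono fun α u => ext_mono fun β v => ?_
    change del (.inr i) (mul (mono α u : O F n) (mono β v)) =
      mul (del (.inr i) (mono α u)) (mono β v) +
        mul (parityInv (mono α u)) (del (.inr i) (mono β v))
    rw [mul_mono, del_inr_mono, del_inr_mono, parityInv_mono]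
    by_cases hu : i ∈ u <;> by_cases hv : i ∈ v
    · have huv : ¬ Disjoint u v := fun h => Finset.disjoint_left.1 h hu hv
      have h1 : Disjoint (u.erase i) v ↔ Disjoint (u.erase i) (v.erase i) := by
        simp only [Finset.disjoint_left, Finset.mem_erase]
        grind
      have h2 : Disjoint u (v.erase i) ↔ Disjoint (u.erase i) (v.erase i) := by
        simp only [Finset.disjoint_left, Finset.mem_erase]
        grind
      rw [if_neg huv, if_pos hu, if_pos hv, map_zero]
      simp only [map_smul, LinearMap.smul_apply, mul_mono, h1, h2]
      split_ifs with h
      · have e : u.erase i ∪ v = u ∪ v.erase i := by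
          ext j
          simp only [Finset.mem_union, Finset.mem_erase]
          grind
        rw [e, smul_smul, smul_smul, smul_smul, ← add_smul, sgn_split_right hv (u.erase i),
          sgn_split_left hu (v.erase i), sgn_swap_singleton (Finset.notMem_erase i u),
          sgn_singleton_erase, sgn_singleton_erase, ← Finset.card_erase_add_one hu]
        have a1 := sgn_mul_self (F := F) {i} u
        have a2 := sgn_mul_self (F := F) {i} v
        rw [eq_comm]
        convert zero_smul F _
        linear_combination ((-1 : F) ^ (u.erase i).card * sgn F (u.erase i) (v.erase i) *
          (binom α β : F)) * (a1 - a2)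
      · simp
    · have h1 : Disjoint (u.erase i) v ↔ Disjoint u v := by
        simp only [Finset.disjoint_left, Finset.mem_erase]
        grind
      rw [if_pos hu, if_neg hv, map_zero, add_zero, map_smul, LinearMap.smul_apply, mul_mono]
      simp only [h1]
      split_ifs with h
      · rw [map_smul, del_inr_mono, if_pos (Finset.mem_union_left _ hu), Finset.erase_union_distrib,
          Finset.erase_eq_of_notMem hv, smul_smul, smul_smul, sgn_union_right h,
          sgn_split_left hu v]
        congr 1
        linear_combination (sgn F (u.erase i) v * (binom α β : F) * sgn F {i} u) *
          sgn_mul_self (F := F) {i} v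
      · simp
    · have h1 : Disjoint u (v.erase i) ↔ Disjoint u v := by
        simp only [Finset.disjoint_left, Finset.mem_erase]
        grind
      rw [if_neg hu, if_pos hv, map_zero, LinearMap.zero_apply, zero_add]
      simp only [map_smul, LinearMap.smul_apply, mul_mono, h1]
      split_ifs with h
      · rw [map_smul, del_inr_mono, if_pos (Finset.mem_union_right _ hv),
          Finset.erase_union_distrib, Finset.erase_eq_of_notMem hu, smul_smul, smul_smul, smul_smul,
          sgn_union_right h, sgn_split_right hv u, sgn_swap_singleton hu]
        congr 1
        linear_combination ((-1 : F) ^ u.card * sgn F u (v.erase i) * (binom α β : F) *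
          sgn F {i} v) * sgn_mul_self (F := F) {i} u
      · simp
    · rw [if_neg hu, if_neg hv]
      split_ifs with h
      · rw [map_smul, del_inr_mono, if_neg (by simp [hu, hv])]
        simp
      · simp
  exact LinearMap.congr_fun (LinearMap.congr_fun key f) g

lemma del_inl_inl (i j : Fin n) (f : O F n) :
    del (.inl i) (del (.inl j) f) = del (.inl j) (del (.inl i) f) := by
  have key : del (F := F) (.inl i) ∘ₗ del (.inl j) = del (.inl j) ∘ₗ del (.inl i) := by
    refine ext_mono fun α u => ?_
    simp only [LinearMap.comp_apply, del_inl_mono]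
    by_cases hij : i = j
    · rw [hij]
    have hji : j ≠ i := fun h => hij h.symm
    by_cases hi : α i = 0 <;> by_cases hj : α j = 0 <;>
      simp [hi, hj, del_inl_mono, hij, hji, tsub_right_comm]
  exact LinearMap.congr_fun key f

lemma del_inl_inr (i j : Fin n) (f : O F n) :
    del (.inl i) (del (.inr j) f) = del (.inr j) (del (.inl i) f) := by
  have key : del (F := F) (.inl i) ∘ₗ del (.inr j) = del (.inr j) ∘ₗ del (.inl i) := by
    refine ext_mono fun α u => ?_
    simp only [LinearMap.comp_apply, del_inl_mono, del_inr_mono]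
    by_cases hi : α i = 0 <;> by_cases hj : j ∈ u <;>
      simp [hi, hj, del_inl_mono, del_inr_mono]
  exact LinearMap.congr_fun key f

lemma del_inr_inr (i j : Fin n) (f : O F n) :
    del (.inr i) (del (.inr j) f) = - del (.inr j) (del (.inr i) f) := by
  have key : del (F := F) (.inr i) ∘ₗ del (.inr j) =
      - (del (F := F) (.inr j) ∘ₗ del (.inr i)) := by
    refine ext_mono fun α u => ?_
    simp only [LinearMap.comp_apply, LinearMap.neg_apply, del_inr_mono]
    by_cases hij : i = j
    · subst hij
      by_cases hi : i ∈ u <;> simp [hi, del_inr_mono]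
    have hji : j ≠ i := fun h => hij h.symm
    by_cases hi : i ∈ u <;> by_cases hj : j ∈ u <;>
      simp [hi, hj, del_inr_mono, hij, hji]
    rw [smul_smul, smul_smul, Finset.erase_right_comm, ← neg_smul]
    congr 1
    rw [sgn_split_right hj {i}, sgn_split_right hi {j},
      sgn_swap_singleton (F := F) (i := j) (u := {i}) (by simpa using hji)]
    simp
    ring
  exact LinearMap.congr_fun key f

lemma TH_apply (a h : O F n) :
    TH a h = ∑ i : Fin n, (mul (del (.inl i) a) (del (.inr i) h) +
      mul (del (.inr i) (parityInv a)) (del (.inl i) h)) := by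
  simp [TH, Finset.sum_add_distrib, mu]

lemma TH_odd {a : O F n} (ha : a ∈ parityPart F n 1) (h : O F n) :
    TH a h = ∑ i : Fin n, (mul (del (.inl i) a) (del (.inr i) h) -
      mul (del (.inr i) a) (del (.inl i) h)) := by
  rw [TH_apply, parityInv_apply ha]
  refine Finset.sum_congr rfl fun i _ => ?_
  rw [show (1 : ZMod 2).val = 1 from rfl, pow_one, neg_smul, one_smul, map_neg, map_neg,
    LinearMap.neg_apply, sub_eq_add_neg]

lemma TH_even {a : O F n} (ha : a ∈ parityPart F n 0) (h : O F n) :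
    TH a h = ∑ i : Fin n, (mul (del (.inl i) a) (del (.inr i) h) +
      mul (del (.inr i) a) (del (.inl i) h)) := by
  rw [TH_apply, parityInv_apply ha]
  simp

lemma TH_mem_parityPart {i j : ZMod 2} {a h : O F n} (ha : a ∈ parityPart F n i)
    (hh : h ∈ parityPart F n j) : TH a h ∈ parityPart F n (i + j + 1) := by
  rw [TH_apply]
  refine Submodule.sum_mem _ fun k _ => add_mem ?_ ?_
  · have := mul_mem_parityPart (del_inl_mem_parityPart k ha) (del_inr_mem_parityPart k hh)
    rwa [← add_assoc] at this
  · have ha' : parityInv a ∈ parityPart F n i := by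
      rw [parityInv_apply ha]
      exact Submodule.smul_mem _ _ ha
    have := mul_mem_parityPart (del_inr_mem_parityPart k ha') (del_inl_mem_parityPart k hh)
    rwa [add_right_comm] at this

lemma TH_mul {a f : O F n} (ha : a ∈ parityPart F n 1) {j : ZMod 2} (hf : f ∈ parityPart F n j)
    (g : O F n) : TH a (mul f g) = mul (TH a f) g + mul f (TH a g) := by
  simp only [TH_odd ha, map_sum, LinearMap.sum_apply]
  rw [← Finset.sum_add_distrib]
  refine Finset.sum_congr rfl fun i _ => ?_
  have h1 : mul (del (.inl i) a) (parityInv f) = mul f (del (.inl i) a) := by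
    rw [parityInv_apply hf, map_smul, mul_comm_parity (del_inl_mem_parityPart i ha) hf, smul_smul,
      show (1 : ZMod 2).val = 1 from rfl, one_mul, ← mul_pow]
    simp
  have h2 : mul (del (.inr i) a) f = mul f (del (.inr i) a) := by
    rw [mul_comm_parity (del_inr_mem_parityPart i ha) hf, show (1 + 1 : ZMod 2).val = 0 from rfl]
    simp
  rw [del_inl_mul, del_inr_mul]
  simp only [map_add, map_sub, LinearMap.sub_apply, ← mul_assoc', h1, h2]
  abel

lemma del_TH_inl {a : O F n} (ha : a ∈ parityPart F n 1) (r : Fin n) (h : O F n) :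
    del (.inl r) (TH a h) = TH a (del (.inl r) h) + TH (del (.inl r) a) h := by
  rw [TH_odd ha, TH_odd ha, TH_odd (del_inl_mem_parityPart r ha), map_sum,
    ← Finset.sum_add_distrib]
  refine Finset.sum_congr rfl fun i _ => ?_
  rw [map_sub, del_inl_mul, del_inl_mul, del_inl_inl r i a, del_inl_inl r i h,
    del_inl_inr r i a, del_inl_inr r i h]
  abel

lemma del_TH_inr {a : O F n} (ha : a ∈ parityPart F n 1) (r : Fin n) (h : O F n) :
    del (.inr r) (TH a h) = TH a (del (.inr r) h) + TH (del (.inr r) a) h := by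
  have h0 : (1 + 1 : ZMod 2) = 0 := rfl
  rw [TH_odd ha, TH_odd ha, TH_even (h0 ▸ del_inr_mem_parityPart r ha), map_sum,
    ← Finset.sum_add_distrib]
  refine Finset.sum_congr rfl fun i _ => ?_
  rw [map_sub, del_inr_mul, del_inr_mul, parityInv_apply (del_inl_mem_parityPart i ha),
    parityInv_apply (del_inr_mem_parityPart i ha), h0, del_inr_inr r i a, del_inr_inr r i h,
    ← del_inl_inr i r a, ← del_inl_inr i r h, show (1 : ZMod 2).val = 1 from rfl,
    show (0 : ZMod 2).val = 0 from rfl, del_inl_inr i r a]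
  simp only [pow_one, pow_zero, neg_smul, one_smul, map_neg, LinearMap.neg_apply]
  abel

lemma TH_bracket {a b : O F n} (ha : a ∈ parityPart F n 1) (hb : b ∈ parityPart F n 1) :
    ⁅TH a, TH b⁆ = TH (TH a b) := by
  have h0 : (1 + 1 : ZMod 2) = 0 := rfl
  have hab : TH a b ∈ parityPart F n 1 := by
    have := TH_mem_parityPart ha hb
    rwa [h0, zero_add] at this
  refine LinearMap.ext fun h => ?_
  have hL : TH a (TH b h) = ∑ i : Fin n,
      (mul (TH a (del (.inl i) b)) (del (.inr i) h) + mul (del (.inl i) b) (TH a (del (.inr i) h)) -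
        (mul (TH a (del (.inr i) b)) (del (.inl i) h) +
          mul (del (.inr i) b) (TH a (del (.inl i) h)))) := by
    rw [TH_odd hb, map_sum]
    refine Finset.sum_congr rfl fun i _ => ?_
    rw [map_sub, TH_mul ha (del_inl_mem_parityPart i hb), TH_mul ha (del_inr_mem_parityPart i hb)]
  have hR : TH b (TH a h) = ∑ i : Fin n,
      (mul (del (.inl i) b) (TH a (del (.inr i) h) + TH (del (.inr i) a) h) -
        mul (del (.inr i) b) (TH a (del (.inl i) h) + TH (del (.inl i) a) h)) := by
    rw [TH_odd hb]
    refine Finset.sum_congr rfl fun i _ => ?_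
    rw [del_TH_inl ha, del_TH_inr ha]
  have hE : TH (TH a b) h = ∑ i : Fin n,
      (mul (TH a (del (.inl i) b) + TH (del (.inl i) a) b) (del (.inr i) h) -
        mul (TH a (del (.inr i) b) + TH (del (.inr i) a) b) (del (.inl i) h)) := by
    rw [TH_odd hab]
    refine Finset.sum_congr rfl fun i _ => ?_
    rw [del_TH_inl ha, del_TH_inr ha]
  have hS : ∑ i : Fin n, (mul (del (.inr i) b) (TH (del (.inl i) a) h) -
        mul (del (.inl i) b) (TH (del (.inr i) a) h)) =
      ∑ i : Fin n, (mul (TH (del (.inl i) a) b) (del (.inr i) h) -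
        mul (TH (del (.inr i) a) b) (del (.inl i) h)) := by
    have e1 : ∀ i : Fin n, mul (del (.inr i) b) (TH (del (.inl i) a) h) -
          mul (del (.inl i) b) (TH (del (.inr i) a) h) =
        ∑ j : Fin n,
          (mul (mul (del (.inl j) (del (.inl i) a)) (del (.inr i) b)) (del (.inr j) h) -
            mul (mul (del (.inr j) (del (.inl i) a)) (del (.inr i) b)) (del (.inl j) h) -
            mul (mul (del (.inl j) (del (.inr i) a)) (del (.inl i) b)) (del (.inr j) h) +
            mul (mul (del (.inr j) (del (.inr i) a)) (del (.inl i) b)) (del (.inl j) h)) := by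
      intro i
      have p1 := del_inl_mem_parityPart i ha
      have p2 : del (.inr i) a ∈ parityPart F n 0 := h0 ▸ del_inr_mem_parityPart i ha
      have q1 := del_inl_mem_parityPart i hb
      have q2 : del (.inr i) b ∈ parityPart F n 0 := h0 ▸ del_inr_mem_parityPart i hb
      rw [TH_odd p1, TH_even p2, map_sum, map_sum, ← Finset.sum_sub_distrib]
      refine Finset.sum_congr rfl fun j _ => ?_
      rw [map_sub, map_add, ← mul_assoc', ← mul_assoc', ← mul_assoc', ← mul_assoc',
        mul_comm_parity q2 (del_inl_mem_parityPart j p1),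
        mul_comm_parity q2 (del_inr_mem_parityPart j p1),
        mul_comm_parity q1 (del_inl_mem_parityPart j p2),
        mul_comm_parity q1 (del_inr_mem_parityPart j p2), h0, zero_add,
        show (1 : ZMod 2).val = 1 from rfl, show (0 : ZMod 2).val = 0 from rfl]
      simp only [mul_zero, mul_one, pow_one, pow_zero, neg_smul, one_smul, map_neg,
        LinearMap.neg_apply]
      abel
    have e2 : ∀ i : Fin n, mul (TH (del (.inl i) a) b) (del (.inr i) h) -
          mul (TH (del (.inr i) a) b) (del (.inl i) h) =
        ∑ j : Fin n,
          (mul (mul (del (.inl j) (del (.inl i) a)) (del (.inr j) b)) (del (.inr i) h) -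
            mul (mul (del (.inr j) (del (.inl i) a)) (del (.inl j) b)) (del (.inr i) h) -
            mul (mul (del (.inl j) (del (.inr i) a)) (del (.inr j) b)) (del (.inl i) h) -
            mul (mul (del (.inr j) (del (.inr i) a)) (del (.inl j) b)) (del (.inl i) h)) := by
      intro i
      have p2 : del (.inr i) a ∈ parityPart F n 0 := h0 ▸ del_inr_mem_parityPart i ha
      rw [TH_odd (del_inl_mem_parityPart i ha), TH_even p2, map_sum, map_sum,
        LinearMap.sum_apply, LinearMap.sum_apply, ← Finset.sum_sub_distrib]
      refine Finset.sum_congr rfl fun j _ => ?_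
      simp only [map_sub, map_add, LinearMap.sub_apply, LinearMap.add_apply]
      abel
    rw [Finset.sum_congr rfl fun i _ => e1 i, Finset.sum_congr rfl fun i _ => e2 i,
      Finset.sum_comm]
    refine Finset.sum_congr rfl fun i _ => Finset.sum_congr rfl fun j _ => ?_
    rw [del_inl_inl i j a, del_inr_inr i j a, del_inl_inr i j a, ← del_inl_inr j i a]
    simp only [map_neg, LinearMap.neg_apply]
    abel
  have hLR : TH a (TH b h) - TH b (TH a h) = ∑ i : Fin n,
      (mul (TH a (del (.inl i) b)) (del (.inr i) h) -
        mul (TH a (del (.inr i) b)) (del (.inl i) h)) +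
      ∑ i : Fin n, (mul (del (.inr i) b) (TH (del (.inl i) a) h) -
        mul (del (.inl i) b) (TH (del (.inr i) a) h)) := by
    rw [hL, hR, ← Finset.sum_sub_distrib, ← Finset.sum_add_distrib]
    refine Finset.sum_congr rfl fun i _ => ?_
    simp only [map_add]
    abel
  change TH a (TH b h) - TH b (TH a h) = TH (TH a b) h
  rw [hLR, hS, hE, ← Finset.sum_add_distrib]
  refine Finset.sum_congr rfl fun i _ => ?_
  simp only [map_add, LinearMap.add_apply]
  abel

lemma parityPart_disjoint {j : ZMod 2} {f : O F n} (h₁ : f ∈ parityPart F n j)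
    (h₂ : f ∈ parityPart F n (j + 1)) : f = 0 := by
  ext x
  by_contra hx
  have m1 : ((x.2.card : ℕ) : ZMod 2) = j := h₁ (Finsupp.mem_support_iff.2 hx)
  have m2 : ((x.2.card : ℕ) : ZMod 2) = j + 1 := h₂ (Finsupp.mem_support_iff.2 hx)
  rw [m1] at m2
  simp at m2

/-- An even element of `HO(n,n;t)` is `T_H(a)` with `a` odd, as `T_H` is odd. -/
lemma exists_odd_of_mem {p : ℕ} {t : Fin n → ℕ} {D : Module.End F (O F n)}
    (hD : D ∈ HO F p t) (hD' : D ∈ evenEnd F n) :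
    ∃ a ∈ OT F p t, a ∈ parityPart F n 1 ∧ TH a = D := by
  classical
  obtain ⟨a, ha, rfl⟩ := hD
  have hz : ∀ c : ZMod 2, c ≠ 1 → c = 0 := by decide
  have hsum := Finsupp.filter_add_filter_not a
    (fun x : (Fin n → ℕ) × Finset (Fin n) => ((x.2.card : ℕ) : ZMod 2) = 1)
  set a₁ := a.filter fun x : (Fin n → ℕ) × Finset (Fin n) => ((x.2.card : ℕ) : ZMod 2) = 1
  set a₀ := a.filter fun x : (Fin n → ℕ) × Finset (Fin n) => ¬ ((x.2.card : ℕ) : ZMod 2) = 1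
  have h1 : a₁ ∈ parityPart F n 1 := fun x hx => (Finset.mem_filter.1 hx).2
  have h0 : a₀ ∈ parityPart F n 0 := fun x hx =>
    hz _ (Finset.mem_filter.1 hx).2
  have hT : a₁ ∈ OT F p t := fun x hx => ha (Finset.mem_filter.1 hx).1
  refine ⟨a₁, hT, h1, ?_⟩
  have hzero : TH a₀ = 0 := by
    refine ext_mono fun α u => ?_
    have hm := mem_parityPart_mono (F := F) (α := α) (u := u) rfl
    have e1 := TH_mem_parityPart h0 hm
    have e2 := TH_mem_parityPart h1 hm
    have e3 := hD' _ _ hm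
    rw [← hsum, map_add, LinearMap.add_apply] at e3
    rw [show (1 : ZMod 2) + (u.card : ZMod 2) + 1 = u.card by
      rw [add_right_comm, show (1 + 1 : ZMod 2) = 0 from rfl, zero_add]] at e2
    rw [zero_add] at e1
    exact parityPart_disjoint ((Submodule.add_mem_iff_right _ e2).1 e3) e1
  rw [← hsum, map_add, hzero, add_zero]

lemma TH_mem_OT {p : ℕ} [Fact p.Prime] [CharP F p] {t : Fin n → ℕ} {a b : O F n}
    (ha : a ∈ OT F p t) (ha' : a ∈ parityPart F n 1) (hb : b ∈ OT F p t) : TH a b ∈ OT F p t := by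
  rw [TH_odd ha']
  exact Submodule.sum_mem _ fun i _ => sub_mem (mul_mem_OT (del_mem_OT _ ha) (del_mem_OT _ hb))
    (mul_mem_OT (del_mem_OT _ ha) (del_mem_OT _ hb))

/-- The Lie algebra `𝓗𝓞`, the even part of `HO(n,n;t)`; on even operators the bracket of the
superalgebra is the commutator. -/
noncomputable def HOeven (F : Type*) [Field F] (p : ℕ) [Fact p.Prime] [CharP F p] {n : ℕ}
    (t : Fin n → ℕ) : LieSubalgebra F (Module.End F (O F n)) where
  __ := HO F p t ⊓ evenEnd F n
  lie_mem' := by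
    rintro D E ⟨hD, hD'⟩ ⟨hE, hE'⟩
    refine ⟨?_, fun j f hf => ?_⟩
    · obtain ⟨a, ha, ha', rfl⟩ := exists_odd_of_mem hD hD'
      obtain ⟨b, hb, hb', rfl⟩ := exists_odd_of_mem hE hE'
      rw [TH_bracket ha' hb']
      exact ⟨_, TH_mem_OT ha ha' hb, rfl⟩
    · exact sub_mem (hD' j _ (hE' j f hf)) (hE' j _ (hD' j f hf))

/-! ### Derivations of `𝓗𝓞`

All spaces of maps below are subspaces of the linear maps from `𝓗𝓞` to the operators on `𝒪(n,n)`. -/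

variable (F) (p : ℕ) [Fact p.Prime] [CharP F p] (t : Fin n → ℕ)

/-- The derivation algebra `Der(𝓗𝓞)`; a derivation is composed with the inclusion of `𝓗𝓞`. -/
noncomputable def derHO : Submodule F (HOeven F p t →ₗ[F] Module.End F (O F n)) where
  carrier := {ψ | ∃ φ : LieDerivation F (HOeven F p t) (HOeven F p t), ∀ E, ψ E = φ E}
  add_mem' := by
    rintro _ _ ⟨φ₁, h₁⟩ ⟨φ₂, h₂⟩
    exact ⟨φ₁ + φ₂, fun E => by simp [h₁, h₂]⟩
  zero_mem' := ⟨0, fun E => by simp⟩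
  smul_mem' := by
    rintro c _ ⟨φ, h⟩
    exact ⟨c • φ, fun E => by simp [h]⟩

/-- Restriction to `𝓗𝓞` of a linear endomorphism of the space of operators on `𝒪(n,n)`. -/
noncomputable def restrictHO : Module.End F (Module.End F (O F n)) →ₗ[F]
    (HOeven F p t →ₗ[F] Module.End F (O F n)) :=
  LinearMap.lcomp F (Module.End F (O F n)) (HOeven F p t).toSubmodule.subtype

/-- `ad(𝓗𝓞 + 𝔽 Γ)`. -/
noncomputable def adHOGam : Submodule F (HOeven F p t →ₗ[F] Module.End F (O F n)) :=
  ((HOeven F p t).toSubmodule ⊔ Submodule.span F {Gam F n}).map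
    (restrictHO F p t ∘ₗ (LieAlgebra.ad F (Module.End F (O F n))).toLinearMap)

/-- The span of the `(ad ∂_i)^{p^k}`, `i ∈ Y₀`, `1 ≤ k < t_i`. -/
noncomputable def adPowers : Submodule F (HOeven F p t →ₗ[F] Module.End F (O F n)) :=
  Submodule.span F {ψ | ∃ (i : Fin n) (k : ℕ), 1 ≤ k ∧ k < t i ∧
    ψ = restrictHO F p t (LieAlgebra.ad F (Module.End F (O F n)) (del (.inl i)) ^ p ^ k)}

end

end OddHamiltonian

namespace OddHamiltonian

section

variable {F : Type*} [Field F] {n : ℕ}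

attribute [local instance] LieRing.ofAssociativeRing

/-! ### Coefficients and brackets of monomials -/

/-! On odd functions `T_H` is injective, and the commutator of `𝓗𝓞` becomes the Poisson-type bracket
`{a, b} = T_H(a)(b)`. A derivation of `𝓗𝓞` is thus a derivation `Φ` of this bracket on the odd part
of `𝒪(n,n;t)`. Two families of elements control it: `x_{i'}` acts as `-∂_i`, and `x_i x_{i'}` acts
diagonally, multiplying `x^(α) x^u` by `[i ∈ u] - α_i`. Only zero is killed by both families.

The derivation is normalized by successive corrections. The `Φ(x_{i'})` satisfy the integrability
conditions for `∂_i z = Φ(x_{i'})`. Truncation could obstruct integration at the top power of `x_i`,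
but `(ad ∂_i)^{p^{t_i}} = 0` removes this obstruction (`IsDer.apply_mono_zero_eq_zero`,
`exists_del_eq`). Subtracting an inner derivation makes `Φ` commute with all `∂_i`; a second one
makes it kill the torus, so that it preserves weights.

Now induct on degree for the elements `x^(α) x_{j'}`: the image is free of even variables, and
weights together with brackets of shorter elements force it to vanish. The exception is `x_i^(p^s)
x_{j'}`, `j ≠ i`, because `binom(p^s, b)` is divisible by `p` for `0 < b < p^s`. There the image may
be a multiple of `x_{j'}`, which is exactly what `∂_i^{p^s}` produces; this is the origin of the
outer `p`-powers (`IsDer.map_mono_singleton_eq_zero`).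

Once these linear elements are killed, `Φ` multiplies `x^(α) x^u` by a scalar `f(u)`. The bracket of
`x_i x^v` with `x^u` makes `f` additive, hence proportional to `|u| - 1`, the eigenvalue of `ad Γ`
(`exists_eq_card_sub_one_mul`, `IsDer.eq_smul_Gam`). The sum is direct because the same test
elements separate the summands. -/

lemma mono_apply (α β : Fin n → ℕ) (u v : Finset (Fin n)) :
    (mono α u : O F n) (β, v) = if α = β ∧ u = v then 1 else 0 := by
  classical
  simp [mono, Finsupp.single_apply]

lemma mono_apply_self (α : Fin n → ℕ) (u : Finset (Fin n)) : (mono α u : O F n) (α, u) = 1 := by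
  simp [mono_apply]

lemma add_single_sub (γ : Fin n → ℕ) (i : Fin n) : γ + Pi.single i 1 - Pi.single i 1 = γ := by
  funext j
  simp

lemma sub_single_add {γ : Fin n → ℕ} {i : Fin n} (h : γ i ≠ 0) :
    γ - Pi.single i 1 + Pi.single i 1 = γ := by
  obtain ⟨γ, rfl⟩ := exists_add_single h
  rw [add_single_sub]

/-- Divided powers acquire no integer factor under `∂_i`, so differentiation only shifts
coefficients. This is what makes integration possible in characteristic `p`. -/
lemma del_inl_apply (i : Fin n) (f : O F n) (γ : Fin n → ℕ) (w : Finset (Fin n)) :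
    del (.inl i) f (γ, w) = f (γ + Pi.single i 1, w) := by
  have key : Finsupp.lapply (R := F) (γ, w) ∘ₗ del (F := F) (.inl i) =
      Finsupp.lapply (γ + Pi.single i 1, w) := by
    refine ext_mono fun α u => ?_
    simp only [LinearMap.comp_apply, Finsupp.lapply_apply, del_inl_mono]
    split_ifs with h
    · rw [mono_apply, if_neg]
      · rfl
      · rintro ⟨rfl, -⟩
        simp at h
    · obtain ⟨α, rfl⟩ := exists_add_single h
      simp [mono_apply]
  exact LinearMap.congr_fun key f

lemma binom_zero_left (β : Fin n → ℕ) : binom 0 β = 1 := by simp [binom]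

lemma binom_zero_right (α : Fin n → ℕ) : binom α 0 = 1 := by simp [binom]

lemma binom_single_left (i : Fin n) (a : ℕ) (β : Fin n → ℕ) :
    binom (Pi.single i a) β = (a + β i).choose a := by
  rw [binom, Finset.prod_eq_single i]
  · simp
  · intro j _ hj
    simp [hj]
  · simp

lemma sgn_ne_zero (u v : Finset (Fin n)) : sgn F u v ≠ 0 :=
  left_ne_zero_of_mul_eq_one (sgn_mul_self u v)

lemma mono_singleton_mem (α : Fin n → ℕ) (i : Fin n) : (mono α {i} : O F n) ∈ parityPart F n 1 :=
  mem_parityPart_mono (by simp)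

lemma sgn_singleton_self (i : Fin n) : sgn F {i} {i} = 1 := by simp [sgn]

/-- The only odd variable present is `x_{i'}`, so one half of the bracket collapses to a single
term. -/
lemma TH_mono_singleton (γ : Fin n → ℕ) (i : Fin n) (h : O F n) :
    TH (mono γ {i}) h = (∑ l : Fin n, if γ l = 0 then 0 else
        mul (mono (γ - Pi.single l 1) {i}) (del (.inr l) h)) -
      mul (mono γ ∅) (del (.inl i) h) := by
  rw [TH_odd (mono_singleton_mem γ i), Finset.sum_sub_distrib]
  congr 1
  · refine Finset.sum_congr rfl fun l _ => ?_
    rw [del_inl_mono]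
    split_ifs <;> simp
  · rw [Finset.sum_eq_single i]
    · simp [del_inr_mono, sgn_singleton_self]
    · intro l _ hl
      simp [del_inr_mono, hl]
    · simp

lemma sgn_empty_left (u : Finset (Fin n)) : sgn F ∅ u = 1 := by simp [sgn]

lemma mul_mono_empty_del (γ β : Fin n → ℕ) (i : Fin n) (u : Finset (Fin n)) :
    mul (mono γ ∅ : O F n) (del (.inl i) (mono β u)) =
      if β i = 0 then 0 else
        (binom γ (β - Pi.single i 1) : F) • mono (γ + (β - Pi.single i 1)) u := by
  rw [del_inl_mono]
  split_ifs <;> simp [mul_mono, sgn_empty_left]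

/-- The bracket of `x^(γ) x_{i'}` and `x^(β) x^u` for `i ∈ u`. -/
lemma TH_mono_of_mem {i : Fin n} {u : Finset (Fin n)} (hi : i ∈ u) (γ β : Fin n → ℕ) :
    TH (mono γ {i} : O F n) (mono β u) =
      (if γ i = 0 then 0 else
        (binom (γ - Pi.single i 1) β : F) • mono (γ - Pi.single i 1 + β) u) -
      (if β i = 0 then 0 else
        (binom γ (β - Pi.single i 1) : F) • mono (γ + (β - Pi.single i 1)) u) := by
  rw [TH_mono_singleton, mul_mono_empty_del]
  congr 1
  rw [Finset.sum_eq_single i]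
  · have hd : Disjoint {i} (u.erase i) := by simp
    rw [del_inr_mono, if_pos hi, map_smul, mul_mono, if_pos hd, sgn_singleton_erase,
      smul_smul, ← mul_assoc, sgn_mul_self, one_mul, ← Finset.insert_eq, Finset.insert_erase hi]
  · intro l _ hl
    have hd : ¬ Disjoint {i} (u.erase l) := by simp [hi, hl.symm]
    rw [del_inr_mono]
    split_ifs
    · rfl
    · rw [map_smul, mul_mono, if_neg hd, smul_zero]
    · rw [map_zero]
  · simp

/-- The bracket of `x^(γ) x_{i'}` and `x^(β) x^u` for `i ∉ u` when `γ` does not meet `u`. -/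
lemma TH_mono_of_notMem {i : Fin n} {u : Finset (Fin n)} {γ : Fin n → ℕ}
    (hγ : ∀ l ∈ u, γ l = 0) (β : Fin n → ℕ) :
    TH (mono γ {i} : O F n) (mono β u) =
      - (if β i = 0 then 0 else
        (binom γ (β - Pi.single i 1) : F) • mono (γ + (β - Pi.single i 1)) u) := by
  rw [TH_mono_singleton, mul_mono_empty_del, Finset.sum_eq_zero, zero_sub]
  intro l _
  split_ifs with h
  · rfl
  · rw [del_inr_mono, if_neg fun hl => h (hγ l hl), map_zero]

/-- The bracket of `x^(γ) x_{k'}` and `x^(β) x_{i'}`. -/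
lemma TH_mono_mono_singleton (k i : Fin n) (γ β : Fin n → ℕ) :
    TH (mono γ {k} : O F n) (mono β {i}) =
      (if γ i = 0 then 0 else
        (binom (γ - Pi.single i 1) β : F) • mono (γ - Pi.single i 1 + β) {k}) -
      (if β k = 0 then 0 else
        (binom γ (β - Pi.single k 1) : F) • mono (γ + (β - Pi.single k 1)) {i}) := by
  rw [TH_mono_singleton, mul_mono_empty_del]
  congr 1
  rw [Finset.sum_eq_single i]
  · simp [del_inr_mono, mul_mono, sgn_singleton_self]
    simp [sgn]
  · intro l _ hl
    simp [del_inr_mono, hl]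
  · simp

/-- The operators `-∂_i` are therefore inner, so that relations between `Φ` and `∂_i` are instances
of the Leibniz rule. -/
lemma TH_mono_zero (i : Fin n) (h : O F n) : TH (mono 0 {i}) h = - del (.inl i) h := by
  rw [TH_mono_singleton]
  have : mul (mono 0 ∅ : O F n) = LinearMap.id := by
    refine ext_mono fun α u => ?_
    simp [mul_mono, sgn_empty_left, binom_zero_left]
  simp [this]

/-- The weights lie in the prime field: they determine `u` when `β = 0`, but see `β` only modulo
`p`. -/
lemma TH_torus_mono (i : Fin n) (β : Fin n → ℕ) (u : Finset (Fin n)) :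
    TH (mono (Pi.single i 1) {i} : O F n) (mono β u) =
      ((if i ∈ u then 1 else 0) - (β i : F)) • mono β u := by
  by_cases hi : i ∈ u
  · rw [TH_mono_of_mem hi, if_pos hi, if_neg (by simp), tsub_self, binom_zero_left, zero_add,
      sub_smul]
    congr 1
    · simp
    · split_ifs with h
      · simp [h]
      · rw [binom_single_left, add_comm (Pi.single i 1 : Fin n → ℕ), sub_single_add h,
          Nat.choose_one_right, Pi.sub_apply, Pi.single_eq_same,
          Nat.add_sub_cancel' (Nat.pos_of_ne_zero h)]
  · rw [TH_mono_of_notMem, if_neg hi, zero_sub, neg_smul]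
    · congr 1
      split_ifs with h
      · simp [h]
      · rw [binom_single_left, add_comm (Pi.single i 1 : Fin n → ℕ), sub_single_add h,
          Nat.choose_one_right, Pi.sub_apply, Pi.single_eq_same,
          Nat.add_sub_cancel' (Nat.pos_of_ne_zero h)]
    · intro l hl
      have : l ≠ i := fun e => hi (e ▸ hl)
      simp [this]

lemma TH_torus_apply (i : Fin n) (f : O F n) (γ : Fin n → ℕ) (w : Finset (Fin n)) :
    TH (mono (Pi.single i 1) {i}) f (γ, w) =
      ((if i ∈ w then 1 else 0) - (γ i : F)) * f (γ, w) := by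
  have key : Finsupp.lapply (R := F) (γ, w) ∘ₗ TH (mono (Pi.single i 1) {i} : O F n) =
      ((if i ∈ w then 1 else 0) - (γ i : F)) • Finsupp.lapply (γ, w) := by
    refine ext_mono fun α u => ?_
    simp only [LinearMap.comp_apply, LinearMap.smul_apply, Finsupp.lapply_apply, TH_torus_mono,
      Finsupp.smul_apply, mono_apply, smul_eq_mul]
    by_cases h : α = γ ∧ u = w
    · obtain ⟨rfl, rfl⟩ := h
      rfl
    · simp [h]
  exact LinearMap.congr_fun key f

/-- The bracket of `x_i x^v` and `x^u`. -/
lemma TH_single_mono_zero {i : Fin n} {u v : Finset (Fin n)} (hi : i ∈ u)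
    (hv : ((v.card : ℕ) : ZMod 2) = 1) (huv : Disjoint v (u.erase i)) :
    TH (mono (Pi.single i 1) v : O F n) (mono 0 u) =
      (sgn F {i} u * sgn F v (u.erase i)) • mono 0 (v ∪ u.erase i) := by
  rw [TH_odd (mem_parityPart_mono hv), Finset.sum_eq_single i]
  · simp [del_inl_mono, del_inr_mono, hi, mul_mono, huv, binom_zero_left, smul_smul]
  · intro l _ hl
    simp [del_inl_mono, hl]
  · simp

/-- For odd `a` and `b`, each product pairs an odd `∂_i` with an even `∂_{i'}`, so the factors
commute and the two halves of the bracket are exchanged with a sign. -/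
lemma TH_antisymm {a b : O F n} (ha : a ∈ parityPart F n 1) (hb : b ∈ parityPart F n 1) :
    TH a b = - TH b a := by
  rw [TH_odd ha, TH_odd hb, ← Finset.sum_neg_distrib]
  refine Finset.sum_congr rfl fun i _ => ?_
  have h0 : (1 + 1 : ZMod 2).val = 0 := rfl
  rw [mul_comm_parity (del_inl_mem_parityPart i ha) (del_inr_mem_parityPart i hb),
    mul_comm_parity (del_inr_mem_parityPart i ha) (del_inl_mem_parityPart i hb), h0]
  simp

lemma apply_eq_zero_of_odd {a : O F n} (ha : a ∈ parityPart F n 1) {γ : Fin n → ℕ}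
    {w : Finset (Fin n)} (hw : ((w.card : ℕ) : ZMod 2) ≠ 1) : a (γ, w) = 0 := by
  by_contra h
  exact hw (ha (Finsupp.mem_support_iff.2 h))

lemma apply_eq_zero_of_mem_OT {p : ℕ} {t : Fin n → ℕ} {a : O F n} (ha : a ∈ OT F p t)
    {γ : Fin n → ℕ} {w : Finset (Fin n)} {i : Fin n} (hi : p ^ t i ≤ γ i) : a (γ, w) = 0 := by
  by_contra h
  exact hi.not_gt (ha (Finsupp.mem_support_iff.2 h) i)

/-- If all even partial derivatives vanish, then only the terms free of even
variables remain. -/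
lemma apply_eq_zero_of_del {f : O F n} (hf : ∀ i, del (.inl i) f = 0) {γ : Fin n → ℕ} (hγ : γ ≠ 0)
    (w : Finset (Fin n)) : f (γ, w) = 0 := by
  obtain ⟨i, hi⟩ := Function.ne_iff.1 hγ
  rw [← sub_single_add hi, ← del_inl_apply, hf i]
  rfl

/-- The centralizer of the `∂_i` and of the torus in the odd part is zero. -/
lemma eq_zero_of_del_of_torus {a : O F n} (ha : a ∈ parityPart F n 1)
    (h₁ : ∀ i, del (.inl i) a = 0) (h₂ : ∀ i, TH (mono (Pi.single i 1) {i}) a = 0) : a = 0 := by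
  ext ⟨γ, w⟩
  -- A term free of even variables has weight `[i ∈ w]`; by parity `w` is nonempty, so some weight
  -- is `1`.
  by_cases hγ : γ = 0
  · subst hγ
    by_cases hw : w = ∅
    · subst hw
      exact apply_eq_zero_of_odd ha (by simp)
    · obtain ⟨i, hi⟩ := Finset.nonempty_iff_ne_empty.2 hw
      have := TH_torus_apply i a 0 w
      rw [h₂ i] at this
      simpa [hi] using this.symm
  · exact apply_eq_zero_of_del h₁ hγ w

end

end OddHamiltonian

namespace OddHamiltonian

section

variable {F : Type*} [Field F] {n : ℕ}

attribute [local instance] LieRing.ofAssociativeRing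

/-! ### Derivations in terms of generating functions -/

/-- The odd part of `𝒪(n,n;t)`, which `T_H` identifies with `𝓗𝓞`. -/
noncomputable def oddOT (F : Type*) [Field F] (p : ℕ) (t : Fin n → ℕ) :
    Submodule F (O F n) :=
  OT F p t ⊓ parityPart F n 1

lemma mono_mem_oddOT {p : ℕ} {t : Fin n → ℕ} {α : Fin n → ℕ} {u : Finset (Fin n)}
    (h : ∀ i, α i < p ^ t i) (hu : ((u.card : ℕ) : ZMod 2) = 1) :
    (mono α u : O F n) ∈ oddOT F p t :=
  ⟨mem_OT_mono h, mem_parityPart_mono hu⟩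

lemma oddOT_induction {p : ℕ} {t : Fin n → ℕ} {P : Submodule F (O F n)}
    (h : ∀ α u, (∀ i, α i < p ^ t i) → ((u.card : ℕ) : ZMod 2) = 1 → mono α u ∈ P) :
    oddOT F p t ≤ P := by
  rw [oddOT, OT, parityPart, ← Finsupp.supported_inter, Finsupp.supported_eq_span_single,
    Submodule.span_le]
  rintro _ ⟨⟨α, u⟩, hu, rfl⟩
  exact h α u hu.1 hu.2

lemma del_inl_mem_oddOT {p : ℕ} {t : Fin n → ℕ} (i : Fin n) {a : O F n} (ha : a ∈ oddOT F p t) :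
    del (.inl i) a ∈ oddOT F p t :=
  ⟨del_mem_OT _ ha.1, del_inl_mem_parityPart i ha.2⟩

lemma del_inl_pow_mem_oddOT {p : ℕ} {t : Fin n → ℕ} (i : Fin n) (m : ℕ) {a : O F n}
    (ha : a ∈ oddOT F p t) : (del (.inl i) ^ m) a ∈ oddOT F p t := by
  induction m with
  | zero => exact ha
  | succ m ih =>
    rw [pow_succ', Module.End.mul_apply]
    exact del_inl_mem_oddOT i ih

lemma TH_mem_parityPart_one {a b : O F n} (ha : a ∈ parityPart F n 1)
    (hb : b ∈ parityPart F n 1) : TH a b ∈ parityPart F n 1 := by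
  have := TH_mem_parityPart ha hb
  rwa [show (1 + 1 : ZMod 2) = 0 from rfl, zero_add] at this

lemma TH_mem_oddOT {p : ℕ} [Fact p.Prime] [CharP F p] {t : Fin n → ℕ} {a b : O F n}
    (ha : a ∈ oddOT F p t) (hb : b ∈ oddOT F p t) : TH a b ∈ oddOT F p t :=
  ⟨TH_mem_OT ha.1 ha.2 hb.1, TH_mem_parityPart_one ha.2 hb.2⟩

lemma del_inl_pow_apply (i : Fin n) (m : ℕ) (f : O F n) (γ : Fin n → ℕ) (w : Finset (Fin n)) :
    (del (.inl i) ^ m) f (γ, w) = f (γ + Pi.single i m, w) := by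
  induction m generalizing f with
  | zero => simp
  | succ m ih =>
    rw [pow_succ, Module.End.mul_apply, ih, del_inl_apply, add_assoc, ← Pi.single_add]

lemma del_inl_pow_eq_zero {p : ℕ} {t : Fin n → ℕ} (i : Fin n) {a : O F n} (ha : a ∈ OT F p t) :
    (del (.inl i) ^ p ^ t i) a = 0 := by
  ext ⟨γ, w⟩
  rw [del_inl_pow_apply]
  exact apply_eq_zero_of_mem_OT ha (i := i) (by simp)

/-! ### Test elements and derivations of the bracket -/

section

variable {p : ℕ} {t : Fin n → ℕ}

lemma zero_lt_bound [hp : Fact p.Prime] (i : Fin n) : (0 : Fin n → ℕ) i < p ^ t i :=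
  pow_pos hp.out.pos _

lemma le_bound [Fact p.Prime] (ht : ∀ i, 1 ≤ t i) (i : Fin n) : p ≤ p ^ t i :=
  Nat.le_self_pow (by have := ht i; omega) p

lemma single_lt_bound [hp : Fact p.Prime] {i : Fin n} {m : ℕ} (hm : m < p ^ t i)
    (j : Fin n) : (Pi.single i m : Fin n → ℕ) j < p ^ t j := by
  by_cases h : j = i
  · subst h
    simpa using hm
  · simpa [h] using pow_pos hp.out.pos _

lemma mono_zero_mem [Fact p.Prime] (i : Fin n) : (mono 0 {i} : O F n) ∈ oddOT F p t :=
  mono_mem_oddOT zero_lt_bound (by simp)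

lemma torus_mem [hp : Fact p.Prime] (ht : ∀ i, 1 ≤ t i) (i : Fin n) :
    (mono (Pi.single i 1) {i} : O F n) ∈ oddOT F p t :=
  mono_mem_oddOT (single_lt_bound (hp.out.one_lt.trans_le (le_bound ht i))) (by simp)

/-- Testing against `x_{i'}` and `x_i x_{i'}` suffices. This gives the injectivity of `T_H` on odd
functions. -/
lemma eq_zero_of_forall_TH [hp : Fact p.Prime] (ht : ∀ i, 1 ≤ t i) {a : O F n}
    (ha : a ∈ parityPart F n 1) (h : ∀ b ∈ oddOT F p t, TH a b = 0) : a = 0 := by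
  refine eq_zero_of_del_of_torus ha (fun i => ?_) fun i => ?_
  · have := h _ (mono_zero_mem i)
    rwa [TH_antisymm ha (mono_singleton_mem _ _), TH_mono_zero, neg_neg] at this
  · have := h _ (torus_mem ht i)
    rwa [TH_antisymm ha (mono_singleton_mem _ _), neg_eq_zero] at this

lemma TH_jacobi {z a : O F n} (hz : z ∈ parityPart F n 1) (ha : a ∈ parityPart F n 1) (b : O F n) :
    TH z (TH a b) = TH (TH z a) b + TH a (TH z b) := by
  have := LinearMap.congr_fun (TH_bracket hz ha) b
  rw [← this]
  change _ = TH z (TH a b) - TH a (TH z b) + _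
  abel

/-- `Φ` restricts to a derivation of the odd part of `𝒪(n,n;t)` with the bracket
`{a, b} = T_H(a)(b)`. -/
structure IsDer (p : ℕ) (t : Fin n → ℕ) (Φ : Module.End F (O F n)) : Prop where
  mem : ∀ a ∈ oddOT F p t, Φ a ∈ oddOT F p t
  leibniz : ∀ a ∈ oddOT F p t, ∀ b ∈ oddOT F p t, Φ (TH a b) = TH (Φ a) b + TH a (Φ b)

namespace IsDer

lemma add {Φ Ψ : Module.End F (O F n)} (h₁ : IsDer p t Φ) (h₂ : IsDer p t Ψ) :
    IsDer p t (Φ + Ψ) where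
  mem a ha := add_mem (h₁.mem a ha) (h₂.mem a ha)
  leibniz a ha b hb := by
    simp only [LinearMap.add_apply, h₁.leibniz a ha b hb, h₂.leibniz a ha b hb, map_add]
    abel

lemma smul (c : F) {Φ : Module.End F (O F n)} (h : IsDer p t Φ) : IsDer p t (c • Φ) where
  mem a ha := Submodule.smul_mem _ c (h.mem a ha)
  leibniz a ha b hb := by
    simp only [LinearMap.smul_apply, h.leibniz a ha b hb, map_smul, smul_add]

lemma zero : IsDer p t (0 : Module.End F (O F n)) where
  mem _ _ := zero_mem _
  leibniz _ _ _ _ := by simp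

lemma sub {Φ Ψ : Module.End F (O F n)} (h₁ : IsDer p t Φ) (h₂ : IsDer p t Ψ) :
    IsDer p t (Φ - Ψ) where
  mem a ha := sub_mem (h₁.mem a ha) (h₂.mem a ha)
  leibniz a ha b hb := by
    simp only [LinearMap.sub_apply, h₁.leibniz a ha b hb, h₂.leibniz a ha b hb, map_sub]
    abel

lemma sum {ι : Type*} (s : Finset ι) {Φ : ι → Module.End F (O F n)}
    (h : ∀ i ∈ s, IsDer p t (Φ i)) : IsDer p t (∑ i ∈ s, Φ i) :=
  Finset.sum_induction _ _ (fun _ _ h₁ h₂ => h₁.add h₂) zero h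

lemma inner [Fact p.Prime] [CharP F p] {z : O F n} (hz : z ∈ oddOT F p t) : IsDer p t (TH z) where
  mem _ ha := TH_mem_oddOT hz ha
  leibniz _ ha b _ := TH_jacobi hz.2 ha.2 b

end IsDer

/-- `ad X` is the difference of the commuting operators of left and right multiplication by `X`, and
`p^k`-th powers are additive on commuting elements in characteristic `p`. -/
lemma ad_pow_char_pow [hp : Fact p.Prime] [CharP F p] (X : Module.End F (O F n)) (k : ℕ) :
    LieAlgebra.ad F (Module.End F (O F n)) X ^ p ^ k =
      LieAlgebra.ad F (Module.End F (O F n)) (X ^ p ^ k) := by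
  have : CharP (Module.End F (Module.End F (O F n))) p :=
    charP_of_injective_algebraMap (algebraMap F _).injective p
  rw [LieAlgebra.ad_eq_lmul_left_sub_lmul_right, Pi.sub_apply, Pi.sub_apply,
    sub_pow_char_pow_of_commute _ _ (LinearMap.commute_mulLeft_right X X),
    LinearMap.pow_mulLeft, LinearMap.pow_mulRight]

lemma lie_del_TH {a : O F n} (ha : a ∈ parityPart F n 1) (i : Fin n) :
    ⁅del (F := F) (.inl i), TH a⁆ = TH (del (.inl i) a) := by
  refine LinearMap.ext fun b => ?_
  change del (.inl i) (TH a b) - TH a (del (.inl i) b) = _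
  rw [del_TH_inl ha]
  abel

lemma del_inl_pow_mem_parityPart (i : Fin n) (m : ℕ) {j : ZMod 2} {a : O F n}
    (ha : a ∈ parityPart F n j) : (del (.inl i) ^ m) a ∈ parityPart F n j := by
  induction m with
  | zero => exact ha
  | succ m ih =>
    rw [pow_succ', Module.End.mul_apply]
    exact del_inl_mem_parityPart i ih

lemma ad_del_pow_TH {a : O F n} (ha : a ∈ parityPart F n 1) (i : Fin n) (m : ℕ) :
    (LieAlgebra.ad F (Module.End F (O F n)) (del (.inl i)) ^ m) (TH a) =
      TH ((del (.inl i) ^ m) a) := by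
  induction m with
  | zero => rfl
  | succ m ih =>
    rw [pow_succ', Module.End.mul_apply, ih, LieAlgebra.ad_apply,
      lie_del_TH (del_inl_pow_mem_parityPart i m ha), pow_succ', Module.End.mul_apply]

/-- In characteristic `p` the `p^k`-th power of the derivation `∂_i` is again a derivation, as the
inner binomial terms of the Leibniz formula vanish. Here this comes from `ad_pow_char_pow`. -/
lemma IsDer.del_pow [Fact p.Prime] [CharP F p] (i : Fin n) (k : ℕ) :
    IsDer p t (del (F := F) (.inl i) ^ p ^ k) where
  mem _ ha := del_inl_pow_mem_oddOT i _ ha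
  leibniz a ha b _ := by
    have := ad_del_pow_TH ha.2 i (p ^ k)
    rw [ad_pow_char_pow] at this
    rw [← this]
    change _ = (del (.inl i) ^ p ^ k) (TH a b) - TH a ((del (.inl i) ^ p ^ k) b) + _
    abel

/-! ### The operator `Γ` as the degree in the odd variables -/

lemma mul_mono_del_inr (i : Fin n) (α : Fin n → ℕ) (u : Finset (Fin n)) :
    mul (mono 0 {i} : O F n) (del (.inr i) (mono α u)) = if i ∈ u then mono α u else 0 := by
  rw [del_inr_mono]
  split_ifs with hi
  · have hd : Disjoint {i} (u.erase i) := by simp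
    rw [map_smul, mul_mono, if_pos hd, sgn_singleton_erase, smul_smul, ← mul_assoc, sgn_mul_self,
      binom_zero_left, zero_add, ← Finset.insert_eq, Finset.insert_erase hi]
    simp
  · simp

lemma Gam_mono (α : Fin n → ℕ) (u : Finset (Fin n)) :
    Gam F n (mono α u) = (u.card : F) • mono α u := by
  simp only [Gam, LinearMap.sum_apply, Module.End.mul_apply, mul_mono_del_inr]
  rw [Finset.sum_ite_mem, Finset.univ_inter, Finset.sum_const, Nat.cast_smul_eq_nsmul]

lemma Gam_mul (f g : O F n) : Gam F n (mul f g) = mul (Gam F n f) g + mul f (Gam F n g) := by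
  have key : (mul : O F n →ₗ[F] O F n →ₗ[F] O F n).compr₂ (Gam F n) =
      (mul ∘ₗ Gam F n) + (mul.compl₂ (Gam F n)) := by
    refine ext_mono fun α u => ext_mono fun β v => ?_
    change Gam F n (mul (mono α u : O F n) (mono β v)) =
      mul (Gam F n (mono α u)) (mono β v) + mul (mono α u) (Gam F n (mono β v))
    simp only [Gam_mono, map_smul, LinearMap.smul_apply, mul_mono]
    split_ifs with h
    · rw [map_smul, Gam_mono, ← add_smul, smul_comm, Finset.card_union_of_disjoint h, Nat.cast_add]
    · simp
  exact LinearMap.congr_fun (LinearMap.congr_fun key f) g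

lemma Gam_del_inl (i : Fin n) (f : O F n) :
    Gam F n (del (.inl i) f) = del (.inl i) (Gam F n f) := by
  have key : Gam F n ∘ₗ del (.inl i) = del (.inl i) ∘ₗ Gam F n := by
    refine ext_mono fun α u => ?_
    simp only [LinearMap.comp_apply, Gam_mono, map_smul, del_inl_mono]
    split_ifs <;> simp [Gam_mono]
  exact LinearMap.congr_fun key f

lemma Gam_del_inr (i : Fin n) (f : O F n) :
    Gam F n (del (.inr i) f) = del (.inr i) (Gam F n f) - del (.inr i) f := by
  have key : Gam F n ∘ₗ del (.inr i) = del (.inr i) ∘ₗ Gam F n - del (.inr i) := by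
    refine ext_mono fun α u => ?_
    simp only [LinearMap.comp_apply, LinearMap.sub_apply, Gam_mono, map_smul, del_inr_mono]
    split_ifs with h
    · rw [map_smul, Gam_mono, ← Finset.card_erase_add_one h, smul_comm]
      push_cast
      rw [add_smul, one_smul, add_sub_cancel_right]
    · simp
  exact LinearMap.congr_fun key f

lemma Gam_mem_parityPart {j : ZMod 2} {a : O F n} (ha : a ∈ parityPart F n j) :
    Gam F n a ∈ parityPart F n j := by
  have : parityPart F n j ≤ (parityPart F n j).comap (Gam F n) := by
    refine parityPart_induction fun α u hu => ?_
    rw [Submodule.mem_comap, Gam_mono]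
    exact Submodule.smul_mem _ _ (mem_parityPart_mono hu)
  exact this ha

lemma Gam_mem_oddOT {a : O F n} (ha : a ∈ oddOT F p t) : Gam F n a ∈ oddOT F p t := by
  have : oddOT F p t ≤ (oddOT F p t).comap (Gam F n) := by
    refine oddOT_induction fun α u hα hu => ?_
    rw [Submodule.mem_comap, Gam_mono]
    exact Submodule.smul_mem _ _ (mono_mem_oddOT hα hu)
  exact this ha

/-- Every term of the bracket contains exactly one `∂_{i'}` and so lowers the odd degree by one.
Hence the degree must be shifted by `-1` to give a derivation. -/
lemma lie_Gam_TH {a : O F n} (ha : a ∈ parityPart F n 1) :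
    ⁅Gam F n, TH a⁆ = TH (Gam F n a - a) := by
  refine LinearMap.ext fun b => ?_
  change Gam F n (TH a b) - TH a (Gam F n b) = _
  rw [TH_odd ha, TH_odd ha, TH_odd (sub_mem (Gam_mem_parityPart ha) ha), map_sum,
    ← Finset.sum_sub_distrib]
  refine Finset.sum_congr rfl fun i _ => ?_
  simp only [map_sub, Gam_mul, Gam_del_inl, Gam_del_inr, LinearMap.sub_apply]
  abel

end

end

end OddHamiltonian

namespace OddHamiltonian

section

variable {F : Type*} [Field F] {n : ℕ}

attribute [local instance] LieRing.ofAssociativeRing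

variable {p : ℕ} {t : Fin n → ℕ}

/-! ### Reduction to derivations that kill the `∂_i` and the torus -/

/-- The element of `𝒪(n,n;t)` with prescribed coefficients. -/
noncomputable def ofCoeff (F : Type*) [Field F] (p : ℕ) (t : Fin n → ℕ)
    (g : (Fin n → ℕ) → Finset (Fin n) → F) : O F n :=
  ∑ x ∈ Fintype.piFinset (fun i => Finset.range (p ^ t i)) ×ˢ Finset.univ,
    g x.1 x.2 • mono x.1 x.2

lemma ofCoeff_apply (g : (Fin n → ℕ) → Finset (Fin n) → F) {γ : Fin n → ℕ} (w : Finset (Fin n))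
    (hγ : ∀ i, γ i < p ^ t i) : ofCoeff F p t g (γ, w) = g γ w := by
  rw [ofCoeff, Finsupp.finsetSum_apply, Finset.sum_eq_single (γ, w)]
  · simp [mono_apply]
  · rintro ⟨α, u⟩ - h
    have : ¬ (α = γ ∧ u = w) := fun e => h (by rw [e.1, e.2])
    simp [mono_apply, this]
  · intro h
    exact absurd (by simpa using hγ) h

lemma ofCoeff_mem {g : (Fin n → ℕ) → Finset (Fin n) → F}
    (hg : ∀ γ w, ((w.card : ℕ) : ZMod 2) ≠ 1 → g γ w = 0) : ofCoeff F p t g ∈ oddOT F p t := by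
  refine Submodule.sum_mem _ fun x hx => ?_
  by_cases h : ((x.2.card : ℕ) : ZMod 2) = 1
  · refine Submodule.smul_mem _ _ (mono_mem_oddOT (fun i => ?_) h)
    have := (Finset.mem_product.1 hx).1
    rw [Fintype.mem_piFinset] at this
    simpa using this i
  · rw [hg _ _ h, zero_smul]
    exact zero_mem _

/-- The Poincaré lemma for truncated divided powers. -/
lemma exists_del_eq {y : Fin n → O F n} (hy : ∀ i, y i ∈ oddOT F p t)
    (hc : ∀ i j, del (.inl i) (y j) = del (.inl j) (y i))
    (ht : ∀ i γ w, γ i + 1 = p ^ t i → y i (γ, w) = 0) :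
    ∃ z ∈ oddOT F p t, ∀ i, del (.inl i) z = y i := by
  classical
  -- A coefficient of the primitive is read off by lowering any nonzero exponent; closedness makes
  -- the choice irrelevant, as `hg` shows.
  let g : (Fin n → ℕ) → Finset (Fin n) → F := fun γ w =>
    if h : ∃ i, γ i ≠ 0 then y h.choose (γ - Pi.single h.choose 1, w) else 0
  have hg : ∀ γ w i, g (γ + Pi.single i 1) w = y i (γ, w) := by
    intro γ w i
    have h : ∃ j, (γ + Pi.single i 1 : Fin n → ℕ) j ≠ 0 := ⟨i, by simp⟩
    simp only [g, dif_pos h]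
    generalize hj : h.choose = j
    have hj' : (γ + Pi.single i 1 : Fin n → ℕ) j ≠ 0 := hj ▸ h.choose_spec
    by_cases hij : j = i
    · subst hij
      rw [add_single_sub]
    · have h0 : γ j ≠ 0 := by simpa [hij] using hj'
      obtain ⟨γ, rfl⟩ := exists_add_single h0
      rw [add_right_comm, add_single_sub, ← del_inl_apply, ← del_inl_apply, hc]
  have hz : ofCoeff F p t g ∈ oddOT F p t := by
    refine ofCoeff_mem fun γ w hw => ?_
    simp only [g]
    split_ifs with h
    · exact apply_eq_zero_of_odd (hy _).2 hw
    · rfl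
  refine ⟨_, hz, fun i => ?_⟩
  ext ⟨γ, w⟩
  rw [del_inl_apply]
  by_cases hγ : ∀ k, γ k < p ^ t k
  -- At the truncation boundary the primitive has no monomial to differentiate, which is why `ht` is
  -- required.
  · by_cases hi : γ i + 1 = p ^ t i
    · rw [ht i γ w hi]
      exact apply_eq_zero_of_mem_OT hz.1 (i := i) (by simp [hi])
    · rw [ofCoeff_apply, hg]
      intro k
      by_cases hk : k = i
      · subst hk
        have := hγ k
        simp
        omega
      · simpa [hk] using hγ k
  · push Not at hγ
    obtain ⟨k, hk⟩ := hγ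
    rw [apply_eq_zero_of_mem_OT (hy i).1 hk]
    exact apply_eq_zero_of_mem_OT hz.1 (i := k) (hk.trans (by simp))

/-- The Leibniz rule for `{x_{i'}, b} = -∂_i b`: the commutator of `∂_i` with `Φ` is the inner
derivation given by `Φ(x_{i'})`. -/
lemma IsDer.map_del {Φ : Module.End F (O F n)} [Fact p.Prime] (h : IsDer p t Φ) (i : Fin n)
    {b : O F n} (hb : b ∈ oddOT F p t) :
    del (.inl i) (Φ b) - Φ (del (.inl i) b) = TH (Φ (mono 0 {i})) b := by
  have := h.leibniz _ (mono_zero_mem i) b hb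
  rw [TH_mono_zero, TH_mono_zero, map_neg] at this
  rw [neg_eq_iff_eq_neg.1 this]
  abel

/-- The coefficients of `Φ(x_{i'})` at the maximal power of `x_i` vanish. -/
lemma IsDer.apply_mono_zero_eq_zero [hp : Fact p.Prime] [CharP F p] (ht : ∀ i, 1 ≤ t i)
    {Φ : Module.End F (O F n)} (h : IsDer p t Φ) (i : Fin n) {γ : Fin n → ℕ}
    (hγ : γ i + 1 = p ^ t i) (w : Finset (Fin n)) : Φ (mono 0 {i}) (γ, w) = 0 := by
  set D : Module.End F (O F n) := del (.inl i)
  set y := Φ (mono 0 {i})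
  have hy : y ∈ oddOT F p t := h.mem _ (mono_zero_mem i)
  have key : ∀ m, ∀ b ∈ oddOT F p t,
      (LieAlgebra.ad F (Module.End F (O F n)) D ^ (m + 1)) Φ b = TH ((D ^ m) y) b := by
    intro m
    induction m with
    | zero =>
      intro b hb
      rw [zero_add, pow_one, pow_zero]
      exact h.map_del i hb
    | succ m ih =>
      intro b hb
      rw [pow_succ', Module.End.mul_apply, LieAlgebra.ad_apply, pow_succ' D, Module.End.mul_apply,
        ← lie_del_TH (del_inl_pow_mem_oddOT i m hy).2]
      change D ((LieAlgebra.ad F (Module.End F (O F n)) D ^ (m + 1)) Φ b) -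
        (LieAlgebra.ad F (Module.End F (O F n)) D ^ (m + 1)) Φ (D b) =
        D (TH ((D ^ m) y) b) - TH ((D ^ m) y) (D b)
      rw [ih b hb, ih _ (del_inl_mem_oddOT i hb)]
  -- Since `γ i + 1 = p^{t i}`, `key` writes the bracket with this element as `ad (D^{p^{t i}})`
  -- applied to `Φ`. That vanishes, because `D^{p^{t i}}` kills `𝒪(n,n;t)`.
  have hz : (D ^ (γ i)) y = 0 := by
    refine eq_zero_of_forall_TH (p := p) (t := t) ht (del_inl_pow_mem_oddOT i _ hy).2 fun b hb => ?_
    rw [← key _ b hb, hγ, ad_pow_char_pow]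
    change (D ^ p ^ t i) (Φ b) - Φ ((D ^ p ^ t i) b) = 0
    rw [del_inl_pow_eq_zero i (h.mem b hb).1, del_inl_pow_eq_zero i hb.1, map_zero, sub_zero]
  -- The wanted coefficient of `y` is that of `D^{γ i} y` at `γ` with its `i`-th exponent removed.
  have e : γ = Function.update γ i 0 + Pi.single i (γ i) := by
    funext j
    by_cases hj : j = i
    · subst hj
      simp
    · simp [hj]
  rw [e, ← del_inl_pow_apply, hz]
  rfl

/-- Modulo inner derivations, every derivation kills the `∂_i`. -/
lemma IsDer.exists_sub_kills_mono_zero [Fact p.Prime] [CharP F p] (ht : ∀ i, 1 ≤ t i)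
    {Φ : Module.End F (O F n)} (h : IsDer p t Φ) :
    ∃ z ∈ oddOT F p t, ∀ i, (Φ - TH z) (mono 0 {i}) = 0 := by
  have hy : ∀ i, Φ (mono 0 {i}) ∈ oddOT F p t := fun i => h.mem _ (mono_zero_mem i)
  -- Closedness is `map_del` at `b = x_{j'}`, which `∂_i` kills.
  obtain ⟨z, hz, e⟩ := exists_del_eq (y := fun i => Φ (mono 0 {i})) hy (fun i j => by
    have := h.map_del i (mono_zero_mem j)
    rwa [del_inl_mono, if_pos (Pi.zero_apply i), map_zero, sub_zero,
      TH_antisymm (hy i).2 (mono_singleton_mem 0 j), TH_mono_zero, neg_neg] at this)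
    fun i γ w hγ => h.apply_mono_zero_eq_zero ht i hγ w
  refine ⟨z, hz, fun i => ?_⟩
  rw [LinearMap.sub_apply, TH_antisymm hz.2 (mono_singleton_mem 0 i), TH_mono_zero, neg_neg, e,
    sub_self]

lemma IsDer.comm_del [Fact p.Prime] {Φ : Module.End F (O F n)} (h : IsDer p t Φ)
    (h₀ : ∀ i, Φ (mono 0 {i}) = 0) (i : Fin n) {b : O F n} (hb : b ∈ oddOT F p t) :
    del (.inl i) (Φ b) = Φ (del (.inl i) b) := by
  have := h.map_del i hb
  rwa [h₀, map_zero, LinearMap.zero_apply, sub_eq_zero] at this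

/-- Modulo inner derivations, every derivation kills the `∂_i` and the torus. -/
lemma IsDer.exists_sub_kills_torus [hp : Fact p.Prime] [CharP F p] (ht : ∀ i, 1 ≤ t i)
    {Φ : Module.End F (O F n)} (h : IsDer p t Φ) (h₀ : ∀ i, Φ (mono 0 {i}) = 0) :
    ∃ z ∈ oddOT F p t, (∀ i, (Φ - TH z) (mono 0 {i}) = 0) ∧
      ∀ i, (Φ - TH z) (mono (Pi.single i 1) {i}) = 0 := by
  classical
  let c : Fin n → O F n := fun i => Φ (mono (Pi.single i 1) {i})
  have hc : ∀ i, c i ∈ oddOT F p t := fun i => h.mem _ (torus_mem ht i)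
  have hdel : ∀ i k, del (.inl k) (c i) = 0 := by
    intro i k
    rw [h.comm_del h₀ k (torus_mem ht i), del_inl_mono]
    split_ifs with hk
    · rw [map_zero]
    · have : k = i := by
        by_contra hki
        simp [hki] at hk
      subst this
      rw [tsub_self, h₀]
  -- Apply `Φ` to the vanishing bracket of two torus elements.
  have hcomm : ∀ i j,
      TH (mono (Pi.single i 1) {i}) (c j) = TH (mono (Pi.single j 1) {j}) (c i) := by
    intro i j
    have := h.leibniz _ (torus_mem ht i) _ (torus_mem ht j)
    rw [TH_torus_mono, TH_antisymm (hc i).2 (mono_singleton_mem _ j)] at this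
    have e : ((if i ∈ ({j} : Finset (Fin n)) then 1 else 0) -
        ((Pi.single j 1 : Fin n → ℕ) i : F)) = 0 := by
      by_cases hij : i = j
      · subst hij
        simp
      · simp [hij]
    rw [e, zero_smul, map_zero] at this
    exact (neg_add_eq_zero.1 this.symm).symm
  have hco : ∀ i j w, (if i ∈ w then c j (0, w) else 0) = if j ∈ w then c i (0, w) else 0 := by
    intro i j w
    have := DFunLike.congr_fun (hcomm i j) (0, w)
    rw [TH_torus_apply, TH_torus_apply] at this
    simpa [ite_mul] using this
  -- As `x_i x_{i'}` acts on `x^w` by `[i ∈ w]`, the coefficient of `z` at `x^w` must be minus that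
  -- of `c i` for each `i ∈ w`. By `hco` these agree, and the same relation makes `c i` vanish at
  -- nonempty `w` not containing `i`.
  let g : (Fin n → ℕ) → Finset (Fin n) → F := fun γ w =>
    if γ = 0 then if hw : w.Nonempty then - c hw.choose (0, w) else 0 else 0
  have hz : ofCoeff F p t g ∈ oddOT F p t := by
    refine ofCoeff_mem fun γ w hw => ?_
    simp only [g]
    split_ifs with h1 h2
    · rw [apply_eq_zero_of_odd (hc _).2 hw, neg_zero]
    · rfl
    · rfl
  have hzdel : ∀ i, del (.inl i) (ofCoeff F p t g) = 0 := by
    intro i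
    ext ⟨γ, w⟩
    rw [del_inl_apply]
    by_cases hγ : ∀ k, (γ + Pi.single i 1 : Fin n → ℕ) k < p ^ t k
    · rw [ofCoeff_apply g w hγ]
      have : γ + Pi.single i 1 ≠ 0 := Function.ne_iff.2 ⟨i, by simp⟩
      simp only [g, if_neg this]
      rfl
    · push Not at hγ
      obtain ⟨k, hk⟩ := hγ
      exact apply_eq_zero_of_mem_OT hz.1 hk
  refine ⟨_, hz, fun i => ?_, fun i => ?_⟩
  · rw [LinearMap.sub_apply, h₀, TH_antisymm hz.2 (mono_singleton_mem 0 i), TH_mono_zero, hzdel]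
    simp
  · rw [LinearMap.sub_apply, TH_antisymm hz.2 (mono_singleton_mem _ i), sub_neg_eq_add]
    change c i + _ = 0
    ext ⟨γ, w⟩
    rw [Finsupp.add_apply, TH_torus_apply]
    by_cases hγ : γ = 0
    · subst hγ
      rw [ofCoeff_apply g w zero_lt_bound]
      simp only [g, if_true]
      by_cases hw : w.Nonempty
      · rw [dif_pos hw]
        have := hco i hw.choose w
        rw [if_pos hw.choose_spec] at this
        rw [← this]
        by_cases hi : i ∈ w <;> simp [hi]
      · rw [dif_neg hw, Finset.not_nonempty_iff_eq_empty.1 hw,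
          apply_eq_zero_of_odd (hc i).2 (by simp)]
        simp
    · rw [apply_eq_zero_of_del (hdel i) hγ, apply_eq_zero_of_del hzdel hγ]
      simp

/-- A derivation that kills the torus preserves the weight spaces. -/
lemma IsDer.weight_eq [Fact p.Prime] (ht : ∀ i, 1 ≤ t i) {Φ : Module.End F (O F n)}
    (h : IsDer p t Φ) (h₁ : ∀ i, Φ (mono (Pi.single i 1) {i}) = 0) {β γ : Fin n → ℕ}
    {v w : Finset (Fin n)} (hm : (mono β v : O F n) ∈ oddOT F p t)
    (hne : Φ (mono β v) (γ, w) ≠ 0) (i : Fin n) :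
    (if i ∈ w then 1 else 0) - (γ i : F) = (if i ∈ v then 1 else 0) - (β i : F) := by
  have := h.leibniz _ (torus_mem ht i) _ hm
  rw [h₁, map_zero, LinearMap.zero_apply, zero_add, TH_torus_mono, map_smul] at this
  have := DFunLike.congr_fun this (γ, w)
  rw [TH_torus_apply, Finsupp.smul_apply, smul_eq_mul] at this
  exact (mul_right_cancel₀ hne this).symm

end

end OddHamiltonian

namespace OddHamiltonian

section

variable {F : Type*} [Field F] {n : ℕ}

attribute [local instance] LieRing.ofAssociativeRing

variable {p : ℕ} {t : Fin n → ℕ}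

/-! ### Derivations on the elements that are linear in the odd variables -/

/-- If `p ∤ a`, take `b = 1`. If `a = p c`, Lucas' congruence `binom(pc, pb) ≡ binom(c, b)` reduces
the claim to `c`. This is what splits `x_i^(a)` into shorter factors. -/
lemma exists_not_dvd_choose (hp : p.Prime) {a : ℕ} (ha : 2 ≤ a) (h : ∀ s, a ≠ p ^ s) :
    ∃ b, 0 < b ∧ b < a ∧ ¬ p ∣ a.choose b := by
  have : Fact p.Prime := ⟨hp⟩
  induction a using Nat.strong_induction_on with
  | _ a ih =>
    by_cases hpa : p ∣ a
    · obtain ⟨c, rfl⟩ := hpa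
      have hc : 2 ≤ c := by
        by_contra hc
        have h1 := h 1
        interval_cases c <;> simp at h1 ha
      have hlt : c < p * c := by nlinarith [hp.two_le]
      obtain ⟨b, hb0, hbc, hb⟩ := ih c hlt hc fun s hs => h (s + 1) (by rw [hs, pow_succ'])
      refine ⟨p * b, Nat.mul_pos hp.pos hb0, Nat.mul_lt_mul_of_pos_left hbc hp.pos, fun hd => hb ?_⟩
      have := Choose.choose_modEq_choose_mod_mul_choose_div_nat (n := p * c) (k := p * b) (p := p)
      rw [Nat.mul_mod_right, Nat.mul_mod_right, Nat.mul_div_cancel_left _ hp.pos,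
        Nat.mul_div_cancel_left _ hp.pos, Nat.choose_self, one_mul] at this
      exact (this.dvd_iff dvd_rfl).1 hd
    · exact ⟨1, one_pos, by omega, by simpa using hpa⟩

lemma natCast_ne_zero_of_lt [CharP F p] {m : ℕ} (h₀ : m ≠ 0) (hm : m < p) : (m : F) ≠ 0 := by
  rw [Ne, CharP.cast_eq_zero_iff F p]
  exact fun hd => hm.not_ge (Nat.le_of_dvd (Nat.pos_of_ne_zero h₀) hd)

lemma IsDer.map_TH_eq_zero {Φ : Module.End F (O F n)} (h : IsDer p t Φ) {a b : O F n}
    (ha : a ∈ oddOT F p t) (hb : b ∈ oddOT F p t) (ha₀ : Φ a = 0) (hb₀ : Φ b = 0) :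
    Φ (TH a b) = 0 := by
  rw [h.leibniz a ha b hb, ha₀, hb₀]
  simp

lemma mono_single_mem {α : Fin n → ℕ} (hα : ∀ i, α i < p ^ t i) (j : Fin n) :
    (mono α {j} : O F n) ∈ oddOT F p t :=
  mono_mem_oddOT hα (by simp)

section

variable [hp : Fact p.Prime] {Φ : Module.End F (O F n)}

/-- If `Φ` kills the monomials of lower degree, then `Φ(x^(α) x_{j'})` is constant in the even
variables. -/
lemma IsDer.apply_mono_of_ne_zero (h : IsDer p t Φ) (h₀ : ∀ i, Φ (mono 0 {i}) = 0)
    {α : Fin n → ℕ} {j : Fin n} (hα : ∀ i, α i < p ^ t i)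
    (ih : ∀ β : Fin n → ℕ, (∀ i, β i < p ^ t i) → ∑ i, β i < ∑ i, α i → ∀ k, Φ (mono β {k}) = 0)
    {γ : Fin n → ℕ} (hγ : γ ≠ 0) (w : Finset (Fin n)) : Φ (mono α {j}) (γ, w) = 0 := by
  refine apply_eq_zero_of_del (fun i => ?_) hγ w
  rw [h.comm_del h₀ i (mono_single_mem hα j), del_inl_mono]
  split_ifs with hi
  · rw [map_zero]
  · refine ih _ (fun k => (Nat.sub_le _ _).trans_lt (hα k)) ?_ j
    conv_rhs => rw [← sub_single_add hi]
    simp [Finset.sum_add_distrib]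

variable [CharP F p]

/-- By weights, `Φ(x^(α) x_{j'})` vanishes if `α_i` is `1` or `2` for some `i ≠ j` and `Φ` kills the
monomials of lower degree. -/
lemma IsDer.map_mono_eq_zero_of_weight (h3 : 3 < p) (ht : ∀ i, 1 ≤ t i) (h : IsDer p t Φ)
    (h₀ : ∀ i, Φ (mono 0 {i}) = 0) (h₁ : ∀ i, Φ (mono (Pi.single i 1) {i}) = 0)
    {α : Fin n → ℕ} {i j : Fin n} (hij : i ≠ j) (hα : ∀ i, α i < p ^ t i)
    (ih : ∀ β : Fin n → ℕ, (∀ i, β i < p ^ t i) → ∑ i, β i < ∑ i, α i → ∀ k, Φ (mono β {k}) = 0)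
    (hi : α i = 1 ∨ α i = 2) : Φ (mono α {j}) = 0 := by
  ext ⟨γ, w⟩
  by_cases hγ : γ = 0
  · by_contra hne
    -- The `i`-weight of `x^(α) x_{j'}` is `-1` or `-2`, that of a term free of even variables `0`
    -- or `1`. Agreement would make `1`, `2` or `3` vanish in `F`; this is where `p > 3` enters.
    have hw := h.weight_eq ht h₁ (mono_single_mem hα j) hne i
    have h1 := natCast_ne_zero_of_lt (F := F) one_ne_zero (by omega : 1 < p)
    have h2 := natCast_ne_zero_of_lt (F := F) two_ne_zero (by omega : 2 < p)
    have h3 := natCast_ne_zero_of_lt (F := F) three_ne_zero h3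
    push_cast at h2 h3
    rcases hi with hi | hi <;> rw [hi, hγ] at hw <;> by_cases hiw : i ∈ w <;>
      simp [hiw, hij] at hw
    · exact h2 (by linear_combination hw)
    · exact h3 (by linear_combination hw)
    · exact h2 (by linear_combination hw)
  · exact h.apply_mono_of_ne_zero h₀ hα ih hγ w

/-- Up to sign the monomial is the bracket of `x_i^(a) x_{i'}` and `x^(β) x_i x_{j'}`, both of lower
degree when `β ≠ 0` and `a ≥ 2`. The case `a = 1` follows from weights. -/
lemma IsDer.map_mono_add_single (h3 : 3 < p) (ht : ∀ i, 1 ≤ t i) (h : IsDer p t Φ)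
    (h₀ : ∀ i, Φ (mono 0 {i}) = 0) (h₁ : ∀ i, Φ (mono (Pi.single i 1) {i}) = 0)
    {β : Fin n → ℕ} {i j : Fin n} {a : ℕ} (hij : i ≠ j) (ha : a ≠ 0) (hβ : β i = 0) (hβ₀ : β ≠ 0)
    (hα : ∀ k, (β + Pi.single i a : Fin n → ℕ) k < p ^ t k)
    (ih : ∀ γ : Fin n → ℕ, (∀ i, γ i < p ^ t i) →
      ∑ k, γ k < ∑ k, (β + Pi.single i a : Fin n → ℕ) k → ∀ k, Φ (mono γ {k}) = 0) :
    Φ (mono (β + Pi.single i a) {j}) = 0 := by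
  by_cases ha1 : a = 1
  · exact h.map_mono_eq_zero_of_weight h3 ht h₀ h₁ hij hα ih (by simp [hβ, ha1])
  have hpos : 0 < ∑ k, β k := by
    obtain ⟨k, hk⟩ := Function.ne_iff.1 hβ₀
    exact Finset.sum_pos' (fun _ _ => Nat.zero_le _) ⟨k, Finset.mem_univ k, Nat.pos_of_ne_zero hk⟩
  have hb : TH (mono (Pi.single i a) {i} : O F n) (mono (β + Pi.single i 1) {j}) =
      - mono (β + Pi.single i a) {j} := by
    rw [TH_mono_of_notMem (by simp [hij.symm]), if_neg (by simp), add_single_sub,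
      binom_single_left, hβ, add_zero, Nat.choose_self, Nat.cast_one, one_smul, add_comm β]
  have hi : a < p ^ t i := by simpa [hβ] using hα i
  have m1 : ∀ k, (Pi.single i a : Fin n → ℕ) k < p ^ t k := single_lt_bound hi
  have m2 : ∀ k, (β + Pi.single i 1 : Fin n → ℕ) k < p ^ t k := by
    intro k
    by_cases hk : k = i
    · subst hk
      simp [hβ]
      omega
    · simpa [hk] using hα k
  have := h.map_TH_eq_zero (mono_single_mem m1 i) (mono_single_mem m2 j)
    (ih _ m1 (by simpa [Finset.sum_add_distrib] using hpos) i)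
    (ih _ m2 (by simp [Finset.sum_add_distrib]; omega) j)
  rwa [hb, map_neg, neg_eq_zero] at this

/-- A power `x_i^(a)` with `a` not a power of `p` splits by a bracket with invertible coefficient
`binom(a, b)`. For `a = p^s`, weights leave only a multiple of `x_{l'}` as the image of `x_i^(a)
x_{l'}`, which `hl` excludes, and the bracket with `x_l x_{j'}` passes from `l` to `j`. -/
lemma IsDer.map_mono_single_of_ne (h3 : 3 < p) (ht : ∀ i, 1 ≤ t i) (h : IsDer p t Φ)
    (h₀ : ∀ i, Φ (mono 0 {i}) = 0) (h₁ : ∀ i, Φ (mono (Pi.single i 1) {i}) = 0)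
    {i j l : Fin n}
    (hl : ∀ s, 1 ≤ s → s < t i → Φ (mono (Pi.single i (p ^ s)) {l}) (0, {l}) = 0)
    {a : ℕ} (hij : i ≠ j) (ha : a ≠ 0) (hai : a < p ^ t i)
    (ih : ∀ γ : Fin n → ℕ, (∀ i, γ i < p ^ t i) → ∑ k, γ k < a → ∀ k, Φ (mono γ {k}) = 0) :
    Φ (mono (Pi.single i a) {j}) = 0 := by
  have hα : ∀ k, (Pi.single i a : Fin n → ℕ) k < p ^ t k := single_lt_bound hai
  have ih' : ∀ γ : Fin n → ℕ, (∀ i, γ i < p ^ t i) →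
      ∑ k, γ k < ∑ k, (Pi.single i a : Fin n → ℕ) k → ∀ k, Φ (mono γ {k}) = 0 := by
    simpa using ih
  by_cases ha2 : a ≤ 2
  · exact h.map_mono_eq_zero_of_weight h3 ht h₀ h₁ hij hα ih' (by simp; omega)
  by_cases hs : ∃ s, a = p ^ s
  · obtain ⟨s, rfl⟩ := hs
    have hs0 : s ≠ 0 := by
      rintro rfl
      simp at ha2
    have hst : s < t i := (Nat.pow_lt_pow_iff_right hp.out.one_lt).1 hai
    have hΦ : Φ (mono (Pi.single i (p ^ s)) {l}) = 0 := by
      ext ⟨γ, w⟩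
      by_cases hγ : γ = 0
      · by_contra hne
        have hw := h.weight_eq ht h₁ (mono_single_mem hα l) hne
        have : w = {l} := by
          ext k
          have := hw k
          have hz : ((Pi.single i (p ^ s) : Fin n → ℕ) k : F) = 0 := by
            by_cases hk : k = i
            · subst hk
              simp [hs0]
            · simp [hk]
          rw [hz, hγ] at this
          by_cases h1 : k ∈ w <;> by_cases h2 : k ∈ ({l} : Finset (Fin n)) <;>
            simp [h1, h2] at this ⊢
        rw [this, hγ] at hne
        exact hne (hl s (Nat.pos_of_ne_zero hs0) hst)
      · exact h.apply_mono_of_ne_zero h₀ hα ih' hγ w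
    by_cases hjl : j = l
    · rw [hjl, hΦ]
    have m2 : ∀ k, (Pi.single l 1 : Fin n → ℕ) k < p ^ t k :=
      single_lt_bound (hp.out.one_lt.trans_le (le_bound ht l))
    have := h.map_TH_eq_zero (mono_single_mem hα l) (mono_single_mem m2 j) hΦ
      (ih _ m2 (by simp; omega) j)
    rw [TH_mono_mono_singleton, if_pos (by simp [hij.symm]), if_neg (by simp), tsub_self, add_zero,
      binom_zero_right, Nat.cast_one, one_smul, zero_sub, map_neg, neg_eq_zero] at this
    exact this
  · push Not at hs
    -- The second factor will be `x_i^(a-b+1) x_{j'}`, of lower degree only for `b ≥ 2`; so `b = 1`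
    -- is replaced by its mirror `a - 1`.
    obtain ⟨b, hb2, hba, hb⟩ : ∃ b, 2 ≤ b ∧ b < a ∧ ¬ p ∣ a.choose b := by
      obtain ⟨b, hb0, hba, hb⟩ := exists_not_dvd_choose hp.out (by omega) hs
      by_cases hb1 : b = 1
      · refine ⟨a - 1, by omega, by omega, ?_⟩
        rwa [Nat.choose_symm (by omega), ← hb1]
      · exact ⟨b, by omega, hba, hb⟩
    have m1 : ∀ k, (Pi.single i b : Fin n → ℕ) k < p ^ t k := single_lt_bound (hba.trans hai)
    have m2 : ∀ k, (Pi.single i (a - b) + Pi.single i 1 : Fin n → ℕ) k < p ^ t k := by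
      rw [← Pi.single_add]
      exact single_lt_bound (by omega)
    have := h.map_TH_eq_zero (mono_single_mem m1 i) (mono_single_mem m2 j)
      (ih _ m1 (by simpa using hba) i) (ih _ m2 (by simp [Finset.sum_add_distrib]; omega) j)
    rw [TH_mono_of_notMem (by simp [hij.symm]), if_neg (by simp), add_single_sub,
      binom_single_left, Pi.single_eq_same, ← Pi.single_add, Nat.add_sub_cancel' hba.le, map_neg,
      neg_eq_zero, map_smul, smul_eq_zero] at this
    exact this.resolve_left (by rwa [CharP.cast_eq_zero_iff F p])

/-- A derivation that kills the `∂_i`, the torus and the leading terms at `x_i^(p^s)` kills all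
elements that are linear in the odd variables. -/
lemma IsDer.map_mono_singleton_eq_zero (h3 : 3 < p) (ht : ∀ i, 1 ≤ t i) (h : IsDer p t Φ)
    (h₀ : ∀ i, Φ (mono 0 {i}) = 0) (h₁ : ∀ i, Φ (mono (Pi.single i 1) {i}) = 0)
    {l : Fin n → Fin n} (hl : ∀ i, l i ≠ i)
    (hpow : ∀ i s, 1 ≤ s → s < t i → Φ (mono (Pi.single i (p ^ s)) {l i}) (0, {l i}) = 0)
    {α : Fin n → ℕ} (hα : ∀ i, α i < p ^ t i) (j : Fin n) : Φ (mono α {j}) = 0 := by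
  induction hm : ∑ i, α i using Nat.strong_induction_on generalizing α j with
  | _ m IH =>
  subst hm
  have ih : ∀ β : Fin n → ℕ, (∀ i, β i < p ^ t i) → ∑ i, β i < ∑ i, α i →
      ∀ k, Φ (mono β {k}) = 0 := fun β hβ hlt k => IH _ hlt hβ k rfl
  by_cases hi : ∃ i, i ≠ j ∧ α i ≠ 0
  · obtain ⟨i, hij, hi⟩ := hi
    have e : α = Function.update α i 0 + Pi.single i (α i) := by
      funext k
      by_cases hk : k = i
      · subst hk
        simp
      · simp [hk]
    by_cases hβ : Function.update α i 0 = 0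
    · rw [hβ, zero_add] at e
      rw [e]
      refine h.map_mono_single_of_ne h3 ht h₀ h₁ (hpow i) hij hi (hα i) fun γ hγ hlt k =>
        ih γ hγ ?_ k
      rw [e]
      simpa using hlt
    · rw [e] at ih hα
      rw [e]
      exact h.map_mono_add_single h3 ht h₀ h₁ hij hi (by simp) hβ hα ih
  · push Not at hi
    obtain ⟨a, rfl⟩ : ∃ a, α = Pi.single j a := by
      refine ⟨α j, funext fun k => ?_⟩
      by_cases hk : k = j
      · subst hk
        simp
      · simp [hk, hi k hk]
    have haj : a < p ^ t j := by simpa using hα j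
    simp only [Finset.sum_pi_single', Finset.mem_univ, if_true] at ih
    by_cases ha0 : a = 0
    · rw [ha0, Pi.single_zero, h₀]
    by_cases ha1 : a = 1
    · rw [ha1, h₁]
    -- It remains to treat `x_j^(a) x_{j'}` with `a ≥ 2`. The bracket of `x_j^(a) x_{k'}` and `x_k
    -- x_{j'}` is `x_j^(a-1) x_k x_{k'} - x_j^(a) x_{j'}`, and all its other ingredients are killed.
    set k := l j
    have hk : k ≠ j := hl j
    have m2 : ∀ i, (Pi.single k 1 : Fin n → ℕ) i < p ^ t i :=
      single_lt_bound (hp.out.one_lt.trans_le (le_bound ht k))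
    have z1 : Φ (mono (Pi.single j a) {k}) = 0 :=
      h.map_mono_single_of_ne h3 ht h₀ h₁ (hpow j) hk.symm ha0 haj ih
    have m3 : ∀ i, (Pi.single k 1 + Pi.single j (a - 1) : Fin n → ℕ) i < p ^ t i := by
      intro i
      by_cases hij : i = j
      · subst hij
        simp [hk.symm]
        omega
      · simpa [hij] using m2 i
    have z2 : Φ (mono (Pi.single k 1 + Pi.single j (a - 1)) {k}) = 0 := by
      refine h.map_mono_add_single h3 ht h₀ h₁ hk.symm (by omega) (by simp [hk.symm])
        (fun e => ?_) m3 fun γ hγ hlt i => ih γ hγ ?_ i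
      · simpa using congrFun e k
      · refine hlt.trans_eq ?_
        simp [Finset.sum_add_distrib]
        omega
    have hsub : (Pi.single j a - Pi.single j 1 : Fin n → ℕ) = Pi.single j (a - 1) := by
      funext i
      by_cases hij : i = j
      · subst hij
        simp
      · simp [hij]
    have := h.map_TH_eq_zero (mono_single_mem hα k) (mono_single_mem m2 j) z1
      (ih _ m2 (by simp; omega) j)
    rw [TH_mono_mono_singleton, if_neg (by simpa using ha0), if_neg (by simp), tsub_self, add_zero,
      binom_zero_right, Nat.cast_one, one_smul, map_sub, map_smul, hsub,
      add_comm (Pi.single j (a - 1) : Fin n → ℕ), z2, smul_zero, zero_sub, neg_eq_zero] at this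
    exact this

end

end

end OddHamiltonian

namespace OddHamiltonian

section

variable {F : Type*} [Field F] {n : ℕ}

attribute [local instance] LieRing.ofAssociativeRing

variable {p : ℕ} {t : Fin n → ℕ}

/-! ### Every derivation is of the asserted form -/

/-- A combination of the `∂_i^{p^k}`, `1 ≤ k < t_i`. -/
noncomputable def delPowers (F : Type*) [Field F] (p : ℕ) (t : Fin n → ℕ) (d : Fin n → ℕ → F) :
    Module.End F (O F n) :=
  ∑ i, ∑ k ∈ Finset.Ico 1 (t i), d i k • del (.inl i) ^ p ^ k

lemma delPowers_apply (d : Fin n → ℕ → F) (f : O F n) :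
    delPowers F p t d f =
      ∑ i, ∑ k ∈ Finset.Ico 1 (t i), d i k • (del (.inl i) ^ p ^ k) f := by
  simp [delPowers]

lemma IsDer.delPowers [Fact p.Prime] [CharP F p] (d : Fin n → ℕ → F) :
    IsDer p t (delPowers F p t d) :=
  IsDer.sum _ fun i _ => IsDer.sum _ fun k _ => (IsDer.del_pow i k).smul _

lemma del_inl_pow_mono_eq_zero {i : Fin n} {m : ℕ} {α : Fin n → ℕ} (h : α i < m)
    (u : Finset (Fin n)) : (del (.inl i) ^ m) (mono α u : O F n) = 0 := by
  ext ⟨γ, w⟩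
  rw [del_inl_pow_apply, mono_apply, if_neg]
  · rfl
  · rintro ⟨rfl, -⟩
    simp at h

lemma delPowers_mono_eq_zero [hp : Fact p.Prime] (d : Fin n → ℕ → F) {α : Fin n → ℕ}
    (h : ∀ i, α i ≤ 1) (u : Finset (Fin n)) : delPowers F p t d (mono α u) = 0 := by
  rw [delPowers_apply]
  refine Finset.sum_eq_zero fun i _ => Finset.sum_eq_zero fun k hk => ?_
  have hk1 := (Finset.mem_Ico.1 hk).1
  rw [del_inl_pow_mono_eq_zero ((h i).trans_lt (Nat.one_lt_pow (by omega) hp.out.one_lt)),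
    smul_zero]

lemma delPowers_mono_single [hp : Fact p.Prime] (d : Fin n → ℕ → F) {i : Fin n} {s : ℕ}
    (hs : 1 ≤ s) (hst : s < t i) (u : Finset (Fin n)) :
    delPowers F p t d (mono (Pi.single i (p ^ s)) u) (0, u) = d i s := by
  rw [delPowers_apply, Finsupp.finsetSum_apply, Finset.sum_eq_single i, Finsupp.finsetSum_apply,
    Finset.sum_eq_single s]
  · rw [Finsupp.smul_apply, del_inl_pow_apply, zero_add, mono_apply_self, smul_eq_mul, mul_one]
  · intro k _ hk
    rw [Finsupp.smul_apply, del_inl_pow_apply, zero_add, mono_apply, if_neg, smul_zero]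
    rintro ⟨e, -⟩
    have := congrFun e i
    simp only [Pi.single_eq_same] at this
    exact hk (Nat.pow_right_injective hp.out.two_le this).symm
  · intro h
    exact absurd (Finset.mem_Ico.2 ⟨hs, hst⟩) h
  · intro j _ hj
    rw [Finsupp.finsetSum_apply]
    refine Finset.sum_eq_zero fun k _ => ?_
    rw [Finsupp.smul_apply, del_inl_pow_apply, zero_add, mono_apply, if_neg, smul_zero]
    rintro ⟨e, -⟩
    have := congrFun e i
    simp [hj.symm, hp.out.ne_zero] at this
  · simp

/-- For each `i` one index `l i ≠ i` suffices: `d i s` is the coefficient of `x_{l'}` in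
`Φ(x_i^(p^s) x_{l'})`, `l = l i`. The powers `∂_i^{p^s}`, `s ≥ 1`, kill exponents at most `1`, so
the earlier normalization survives. -/
lemma IsDer.exists_sub_kills_linear [hp : Fact p.Prime] [CharP F p] (h3 : 3 < p) (hn : 2 ≤ n)
    (ht : ∀ i, 1 ≤ t i) {Φ : Module.End F (O F n)} (h : IsDer p t Φ)
    (h₀ : ∀ i, Φ (mono 0 {i}) = 0) (h₁ : ∀ i, Φ (mono (Pi.single i 1) {i}) = 0) :
    ∃ d, ∀ α : Fin n → ℕ, (∀ i, α i < p ^ t i) →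
      ∀ j, (Φ - OddHamiltonian.delPowers F p t d) (mono α {j}) = 0 := by
  have : Nontrivial (Fin n) := Fin.nontrivial_iff_two_le.2 hn
  choose l hl using fun i : Fin n => exists_ne i
  refine ⟨fun i s => Φ (mono (Pi.single i (p ^ s)) {l i}) (0, {l i}), fun α hα j => ?_⟩
  refine (h.sub (IsDer.delPowers _)).map_mono_singleton_eq_zero h3 ht (fun i => ?_) (fun i => ?_)
    hl (fun i s hs hst => ?_) hα j
  · rw [LinearMap.sub_apply, h₀, delPowers_mono_eq_zero _ (by simp), sub_zero]
  · rw [LinearMap.sub_apply, h₁, delPowers_mono_eq_zero, sub_zero]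
    intro k
    by_cases hk : k = i
    · subst hk
      simp
    · simp [hk]
  · rw [LinearMap.sub_apply, Finsupp.sub_apply, delPowers_mono_single _ hs hst, sub_self]

/-! ### Monomials of arbitrary odd degree -/

section

variable [hp : Fact p.Prime] {Φ : Module.End F (O F n)}

lemma nonempty_of_odd {u : Finset (Fin n)} (hu : ((u.card : ℕ) : ZMod 2) = 1) : u.Nonempty := by
  rw [Finset.nonempty_iff_ne_empty]
  rintro rfl
  simp at hu

/-- Commuting with the `∂_i` keeps the image free of even variables, where the torus weights `[i ∈
w]` tell the `x^w` apart. -/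
lemma IsDer.map_mono_zero (ht : ∀ i, 1 ≤ t i) (h : IsDer p t Φ)
    (h₀ : ∀ i, Φ (mono 0 {i}) = 0) (h₁ : ∀ i, Φ (mono (Pi.single i 1) {i}) = 0)
    {u : Finset (Fin n)} (hu : ((u.card : ℕ) : ZMod 2) = 1) :
    Φ (mono 0 u) = Φ (mono 0 u) (0, u) • mono 0 u := by
  have hm : (mono 0 u : O F n) ∈ oddOT F p t := mono_mem_oddOT zero_lt_bound hu
  ext ⟨γ, w⟩
  rw [Finsupp.smul_apply, mono_apply]
  split_ifs with hγw
  · rw [← hγw.1, ← hγw.2, smul_eq_mul, mul_one]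
  · rw [smul_zero]
    by_contra hne
    have hγ : γ = 0 := by
      by_contra hγ
      refine hne (apply_eq_zero_of_del (fun i => ?_) hγ w)
      rw [h.comm_del h₀ i hm, del_inl_mono, if_pos (Pi.zero_apply i), map_zero]
    refine hγw ⟨hγ.symm, ?_⟩
    ext k
    have hw := h.weight_eq ht h₁ hm hne k
    rw [hγ] at hw
    by_cases h1 : k ∈ u <;> by_cases h2 : k ∈ w <;> simp [h1, h2] at hw ⊢

/-- For `i ∈ u`, the bracket of the killed element `x^(β+ε_i) x_{i'}` with `x^u` is `x^(β) x^u`, so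
even factors do not change the eigenvalue. If `α_i` is maximal, this element does not exist; the
bracket of `x_i^(2) x_{i'}` with `x^(α-ε_i) x^u` is used instead. -/
lemma IsDer.map_mono [CharP F p] (h3 : 3 < p) (ht : ∀ i, 1 ≤ t i) (h : IsDer p t Φ)
    (hk : ∀ α : Fin n → ℕ, (∀ i, α i < p ^ t i) → ∀ j, Φ (mono α {j}) = 0)
    {α : Fin n → ℕ} (hα : ∀ i, α i < p ^ t i) {u : Finset (Fin n)}
    (hu : ((u.card : ℕ) : ZMod 2) = 1) :
    Φ (mono α u) = Φ (mono 0 u) (0, u) • mono α u := by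
  have h₁ : ∀ i, Φ (mono (Pi.single i 1) {i}) = 0 := fun i =>
    hk _ (single_lt_bound (hp.out.one_lt.trans_le (le_bound ht i))) i
  have hm := h.map_mono_zero ht (fun i => hk 0 zero_lt_bound i) h₁ hu
  set c := Φ (mono 0 u) (0, u)
  have hmem : (mono 0 u : O F n) ∈ oddOT F p t := mono_mem_oddOT zero_lt_bound hu
  have step : ∀ β : Fin n → ℕ, (∀ i, β i < p ^ t i) → ∀ i ∈ u, β i + 1 < p ^ t i →
      Φ (mono β u) = c • mono β u := by
    intro β hβ i hi hlt
    have hγ : ∀ k, (β + Pi.single i 1 : Fin n → ℕ) k < p ^ t k := by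
      intro k
      by_cases hki : k = i
      · subst hki
        simpa using hlt
      · simpa [hki] using hβ k
    have := h.leibniz _ (mono_single_mem hγ i) _ hmem
    rwa [hk _ hγ, hm, map_zero, LinearMap.zero_apply, zero_add, map_smul, TH_mono_of_mem hi,
      if_neg (by simp), if_pos (Pi.zero_apply i), add_single_sub, binom_zero_right, Nat.cast_one,
      one_smul, add_zero, sub_zero] at this
  obtain ⟨i, hi⟩ := nonempty_of_odd hu
  by_cases hlt : α i + 1 < p ^ t i
  · exact step α hα i hi hlt
  have hmax : α i + 1 = p ^ t i := le_antisymm (hα i) (not_lt.1 hlt)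
  have hple := le_bound (p := p) ht i
  obtain ⟨β, rfl⟩ := exists_add_single (i := i) (α := α) (by omega)
  obtain ⟨δ, rfl⟩ := exists_add_single (i := i) (α := β) (by simp at hmax; omega)
  simp only [Pi.add_apply, Pi.single_eq_same] at hmax
  have hβ : ∀ k, (δ + Pi.single i 1 : Fin n → ℕ) k < p ^ t k := fun k =>
    lt_of_le_of_lt (Nat.le_add_right _ _) (hα k)
  have h2 : ∀ k, (Pi.single i 1 + Pi.single i 1 : Fin n → ℕ) k < p ^ t k := by
    rw [← Pi.single_add]
    exact single_lt_bound (by omega)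
  have e := h.leibniz _ (mono_single_mem h2 i) _ (mono_mem_oddOT hβ hu)
  have hb : TH (mono (Pi.single i 1 + Pi.single i 1) {i} : O F n) (mono (δ + Pi.single i 1) u) =
      (((δ i + 2 : ℕ) : F) - ((δ i + 2).choose 2 : ℕ)) •
        mono (δ + Pi.single i 1 + Pi.single i 1) u := by
    rw [TH_mono_of_mem hi, if_neg (by simp), if_neg (by simp), add_single_sub, add_single_sub,
      sub_smul, binom_single_left, ← Pi.single_add, binom_single_left]
    congr 2
    · simp
      ring
    · rw [add_comm]
    · rw [add_comm (δ i)]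
    · rw [add_comm, add_assoc, ← Pi.single_add]
  rw [hk _ h2, map_zero, LinearMap.zero_apply, zero_add,
    step _ hβ i hi (by simp; omega), map_smul, hb, map_smul, smul_comm c] at e
  -- The maximal exponent is `m = δ i + 2 ≡ -1`, so the coefficient `m - binom(m, 2)` equals `-2`,
  -- which is nonzero.
  refine smul_right_injective _ ?_ e
  intro hz
  have hcast : ((δ i + 1 + 1 + 1 : ℕ) : F) = 0 := by
    rw [hmax, Nat.cast_pow, CharP.cast_eq_zero, zero_pow]
    have := ht i
    omega
  have hch := congrArg (Nat.cast (R := F)) (Nat.add_one_mul_choose_eq (δ i + 1) 1)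
  rw [Nat.choose_one_right] at hch
  have h4 : (2 : F) * 2 = 0 := by
    push_cast at hz hcast hch
    linear_combination (-2) * hz + (2 - (δ i : F)) * hcast + hch
  have h2' := natCast_ne_zero_of_lt (F := F) (p := p) two_ne_zero (by omega : 2 < p)
  push_cast at h2'
  exact mul_ne_zero h2' h2' h4

end

/-- A function on the sets of odd cardinality that is additive for `(v, u) ↦ v ∪ (u \ {i})` is
proportional to `|u| - 1`. -/
lemma exists_eq_card_sub_one_mul (h2 : (2 : F) ≠ 0) (hn : 3 ≤ n) {f : Finset (Fin n) → F}
    (h1 : ∀ j, f {j} = 0)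
    (hadd : ∀ u v : Finset (Fin n), Odd u.card → Odd v.card → ∀ i ∈ u, Disjoint v (u.erase i) →
      f (v ∪ u.erase i) = f v + f u) :
    ∃ c, ∀ u, Odd u.card → f u = ((u.card : F) - 1) * c := by
  have hcard : ∀ m, ∀ u v : Finset (Fin n), Odd u.card → u.card = v.card → (u \ v).card = m →
      f u = f v := by
    intro m
    induction m with
    | zero =>
      intro u v _ huv h0
      rw [Finset.eq_of_subset_of_card_le (Finset.sdiff_eq_empty_iff_subset.1
        (Finset.card_eq_zero.1 h0)) huv.ge]
    | succ m ih =>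
      intro u v hu huv hm
      obtain ⟨i, hi⟩ : (u \ v).Nonempty := Finset.card_pos.1 (by omega)
      obtain ⟨j, hj⟩ : (v \ u).Nonempty := Finset.card_pos.1 (by
        rw [Finset.card_sdiff_comm huv.symm]; omega)
      rw [Finset.mem_sdiff] at hi hj
      have hd : Disjoint {j} (u.erase i) := by simp [hj.2]
      have e := hadd u {j} hu (by simp) i hi.1 hd
      rw [h1, zero_add] at e
      have hc : ({j} ∪ u.erase i).card = u.card := by
        rw [Finset.card_union_of_disjoint hd, Finset.card_singleton, add_comm,
          Finset.card_erase_add_one hi.1]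
      rw [← e]
      refine ih _ v (hc ▸ hu) (hc.trans huv) ?_
      have : ({j} ∪ u.erase i) \ v = (u \ v).erase i := by
        ext k
        simp only [Finset.mem_sdiff, Finset.mem_union, Finset.mem_singleton, Finset.mem_erase]
        grind
      rw [this, Finset.card_erase_of_mem (by simp [hi]), hm, Nat.add_sub_cancel]
  obtain ⟨u₀, -, hu₀⟩ : ∃ u₀ ⊆ (Finset.univ : Finset (Fin n)), u₀.card = 3 :=
    Finset.exists_subset_card_eq (by simpa using hn)
  refine ⟨f u₀ / 2, fun u => ?_⟩
  induction hm : u.card using Nat.strong_induction_on generalizing u with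
  | _ m ih =>
  subst hm
  intro hu
  by_cases hu1 : u.card = 1
  · obtain ⟨j, rfl⟩ := Finset.card_eq_one.1 hu1
    simp [h1]
  have hu3 : 3 ≤ u.card := by
    obtain ⟨r, hr⟩ := hu
    omega
  -- Merging a 3-set `v` with `{i} ∪ (u \ v)`, `i ∈ v`, gives `u`. So `f` grows by the constant `f
  -- u₀` whenever the cardinality grows by two.
  obtain ⟨v, hvu, hv⟩ := Finset.exists_subset_card_eq hu3
  obtain ⟨i, hi⟩ : v.Nonempty := Finset.card_pos.1 (by omega)
  have hi' : i ∉ u \ v := by simp [hi]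
  have hc : (insert i (u \ v)).card + 2 = u.card := by
    rw [Finset.card_insert_of_notMem hi', Finset.card_sdiff_of_subset hvu]
    omega
  have ho : Odd (insert i (u \ v)).card := by
    obtain ⟨r, hr⟩ := hu
    exact ⟨r - 1, by omega⟩
  have e := hadd (insert i (u \ v)) v ho (by rw [hv]; decide) i (Finset.mem_insert_self _ _)
    (by rw [Finset.erase_insert hi']; exact Finset.disjoint_sdiff)
  rw [Finset.erase_insert hi', Finset.union_sdiff_of_subset hvu,
    hcard _ v u₀ (by rw [hv]; decide) (hv.trans hu₀.symm) rfl, ih _ (by omega) _ rfl ho] at e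
  rw [e, ← hc]
  push_cast
  field_simp
  ring

/-- A derivation that kills the elements that are linear in the odd variables is a multiple of the
degree derivation. -/
lemma IsDer.eq_smul_Gam [hp : Fact p.Prime] [CharP F p] (h3 : 3 < p) (hn : 3 ≤ n)
    (ht : ∀ i, 1 ≤ t i) {Φ : Module.End F (O F n)} (h : IsDer p t Φ)
    (hk : ∀ α : Fin n → ℕ, (∀ i, α i < p ^ t i) → ∀ j, Φ (mono α {j}) = 0) :
    ∃ c : F, ∀ a ∈ oddOT F p t, Φ a = c • (Gam F n a - a) := by
  have h2 := natCast_ne_zero_of_lt (F := F) (p := p) two_ne_zero (by omega : 2 < p)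
  push_cast at h2
  obtain ⟨c, hc⟩ := exists_eq_card_sub_one_mul (f := fun u => Φ (mono 0 u) (0, u)) h2 hn
    (fun j => by simp [hk 0 zero_lt_bound j]) (fun u v hu hv i hi hd => by
      have hu' := ZMod.natCast_eq_one_iff_odd.2 hu
      have hv' := ZMod.natCast_eq_one_iff_odd.2 hv
      have hs : ∀ k, (Pi.single i 1 : Fin n → ℕ) k < p ^ t k :=
        single_lt_bound (hp.out.one_lt.trans_le (le_bound ht i))
      -- By `map_mono`, `x_i x^v` has the eigenvalue of `x^v`, and its bracket with `x^u` is `± x^(v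
      -- ∪ u \ {i})`; comparing eigenvalues gives additivity.
      have e := h.leibniz _ (mono_mem_oddOT hs hv') _ (mono_mem_oddOT zero_lt_bound hu')
      rw [h.map_mono h3 ht hk hs hv', h.map_mono h3 ht hk zero_lt_bound hu', map_smul, map_smul,
        LinearMap.smul_apply, ← add_smul, TH_single_mono_zero hi hv' hd, map_smul] at e
      have e' := DFunLike.congr_fun e (0, v ∪ u.erase i)
      simp only [Finsupp.smul_apply, mono_apply_self, smul_eq_mul, mul_one] at e'
      have hne := mul_ne_zero (sgn_ne_zero (F := F) {i} u) (sgn_ne_zero (F := F) v (u.erase i))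
      refine mul_left_cancel₀ hne ?_
      rw [e']
      ring)
  refine ⟨c, fun a ha => ?_⟩
  have : oddOT F p t ≤ LinearMap.eqLocus Φ (c • (Gam F n - 1)) := by
    refine oddOT_induction fun α u hα hu => ?_
    rw [LinearMap.mem_eqLocus, h.map_mono h3 ht hk hα hu, LinearMap.smul_apply,
      LinearMap.sub_apply, Module.End.one_apply, Gam_mono,
      hc u (ZMod.natCast_eq_one_iff_odd.1 hu), mul_comm, mul_smul, sub_smul, one_smul]
  exact this ha

/-- The structure of the derivations of the odd part of `𝒪(n,n;t)`. -/
theorem IsDer.exists_eq [hp : Fact p.Prime] [CharP F p] (h3 : 3 < p) (hn : 3 ≤ n)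
    (ht : ∀ i, 1 ≤ t i) {Φ : Module.End F (O F n)} (h : IsDer p t Φ) :
    ∃ z ∈ oddOT F p t, ∃ (c : F) (d : Fin n → ℕ → F), ∀ a ∈ oddOT F p t,
      Φ a = TH z a + c • (Gam F n a - a) + OddHamiltonian.delPowers F p t d a := by
  obtain ⟨z₁, hz₁, e₁⟩ := h.exists_sub_kills_mono_zero ht
  have d₁ := h.sub (IsDer.inner hz₁)
  obtain ⟨z₂, hz₂, e₂, e₂'⟩ := d₁.exists_sub_kills_torus ht e₁
  have d₂ := d₁.sub (IsDer.inner hz₂)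
  obtain ⟨d, hd⟩ := d₂.exists_sub_kills_linear h3 (by omega) ht e₂ e₂'
  obtain ⟨c, hc⟩ := (d₂.sub (IsDer.delPowers d)).eq_smul_Gam h3 hn ht hd
  refine ⟨z₁ + z₂, add_mem hz₁ hz₂, c, d, fun a ha => ?_⟩
  rw [← hc a ha]
  simp only [LinearMap.sub_apply, map_add, LinearMap.add_apply]
  abel

end

end OddHamiltonian

namespace OddHamiltonian

section

variable {F : Type*} [Field F] {n : ℕ}

attribute [local instance] LieRing.ofAssociativeRing

variable {p : ℕ} {t : Fin n → ℕ} [hp : Fact p.Prime]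

/-! ### The derivation algebra of `𝓗𝓞` -/

lemma TH_injOn (ht : ∀ i, 1 ≤ t i) {a b : O F n} (ha : a ∈ oddOT F p t) (hb : b ∈ oddOT F p t)
    (h : TH a = TH b) : a = b := by
  refine sub_eq_zero.1 (eq_zero_of_forall_TH (p := p) (t := t) ht (sub_mem ha hb).2 fun c _ => ?_)
  rw [map_sub, h, sub_self, LinearMap.zero_apply]

variable [CharP F p]

lemma TH_mem_HOeven {a : O F n} (ha : a ∈ oddOT F p t) : TH a ∈ HOeven F p t := by
  refine ⟨⟨a, ha.1, rfl⟩, fun j f hf => ?_⟩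
  have := TH_mem_parityPart ha.2 hf
  rwa [add_right_comm, show (1 + 1 : ZMod 2) = 0 from rfl, zero_add] at this

lemma exists_oddOT_of_mem {D : Module.End F (O F n)} (hD : D ∈ HOeven F p t) :
    ∃ a ∈ oddOT F p t, TH a = D := by
  obtain ⟨a, h1, h2, h3⟩ := exists_odd_of_mem hD.1 hD.2
  exact ⟨a, ⟨h1, h2⟩, h3⟩

/-- `T_H` as an isomorphism from the odd part of `𝒪(n,n;t)` onto `𝓗𝓞`. -/
noncomputable def oddOTEquiv (ht : ∀ i, 1 ≤ t i) : oddOT F p t ≃ₗ[F] HOeven F p t :=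
  LinearEquiv.ofBijective
    (LinearMap.codRestrict (HOeven F p t).toSubmodule (TH ∘ₗ (oddOT F p t).subtype)
      fun a => TH_mem_HOeven a.2)
    ⟨fun a b h => Subtype.ext (TH_injOn ht a.2 b.2 (congrArg Subtype.val h)), fun D => by
      obtain ⟨a, ha, e⟩ := exists_oddOT_of_mem D.2
      exact ⟨⟨a, ha⟩, Subtype.ext e⟩⟩

lemma coe_oddOTEquiv (ht : ∀ i, 1 ≤ t i) (a : oddOT F p t) :
    (oddOTEquiv ht a : Module.End F (O F n)) = TH (a : O F n) := rfl

/-- Every derivation of `𝓗𝓞` comes from a derivation of the odd part of `𝒪(n,n;t)`. -/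
lemma exists_isDer (ht : ∀ i, 1 ≤ t i) (φ : LieDerivation F (HOeven F p t) (HOeven F p t)) :
    ∃ Φ : Module.End F (O F n), IsDer p t Φ ∧ ∀ a (ha : a ∈ oddOT F p t),
      (φ ⟨TH a, TH_mem_HOeven ha⟩ : Module.End F (O F n)) = TH (Φ a) := by
  let e := oddOTEquiv (F := F) (p := p) ht
  let Ψ₀ : oddOT F p t →ₗ[F] oddOT F p t := e.symm.toLinearMap ∘ₗ φ.toLinearMap ∘ₗ e.toLinearMap
  -- The values off the odd part are irrelevant; an arbitrary linear extension turns `Ψ₀` into an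
  -- endomorphism of `𝒪(n,n)`.
  obtain ⟨Ψ, hΨ⟩ := LinearMap.exists_extend (V' := oddOT F p t) (p := oddOT F p t) Ψ₀
  have hval : ∀ a (ha : a ∈ oddOT F p t),
      (φ ⟨TH a, TH_mem_HOeven ha⟩ : Module.End F (O F n)) = TH (Ψ a : O F n) := by
    intro a ha
    have h1 : Ψ a = e.symm (φ (e ⟨a, ha⟩)) := LinearMap.congr_fun hΨ ⟨a, ha⟩
    rw [h1, ← coe_oddOTEquiv ht, LinearEquiv.apply_symm_apply]
    rfl
  refine ⟨(oddOT F p t).subtype ∘ₗ Ψ, ⟨fun a _ => (Ψ a).2, fun a ha b hb => ?_⟩, hval⟩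
  change (Ψ (TH a b) : O F n) = TH (Ψ a : O F n) b + TH a (Ψ b : O F n)
  refine TH_injOn (p := p) (t := t) ht (Ψ _).2
    (add_mem (TH_mem_oddOT (Ψ a).2 hb) (TH_mem_oddOT ha (Ψ b).2)) ?_
  have e1 : (⟨TH (TH a b), TH_mem_HOeven (TH_mem_oddOT ha hb)⟩ : HOeven F p t) =
      ⁅(⟨TH a, TH_mem_HOeven ha⟩ : HOeven F p t), ⟨TH b, TH_mem_HOeven hb⟩⁆ :=
    Subtype.ext (TH_bracket ha.2 hb.2).symm
  rw [← hval _ (TH_mem_oddOT ha hb), e1, φ.apply_lie_eq_add]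
  change ⁅TH a, (φ ⟨TH b, TH_mem_HOeven hb⟩ : Module.End F (O F n))⁆ +
    ⁅(φ ⟨TH a, TH_mem_HOeven ha⟩ : Module.End F (O F n)), TH b⁆ = _
  rw [hval a ha, hval b hb, TH_bracket ha.2 (Ψ b).2.2, TH_bracket (Ψ a).2.2 hb.2, ← map_add,
    add_comm]

/-! ### The two summands as spaces of derivations -/

lemma restrictHO_apply (f : Module.End F (Module.End F (O F n))) (E : HOeven F p t) :
    restrictHO F p t f E = f E := rfl

lemma lie_lie_eq_sub {L : Type*} [LieRing L] (x y z : L) :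
    ⁅x, ⁅y, z⁆⁆ = ⁅y, ⁅x, z⁆⁆ - ⁅z, ⁅x, y⁆⁆ := by
  rw [leibniz_lie, ← lie_skew z]
  abel

/-- An operator that normalizes `𝓗𝓞` induces a derivation. -/
lemma restrictHO_ad_mem_derHO {X : Module.End F (O F n)}
    (hX : ∀ a ∈ oddOT F p t, ∃ b ∈ oddOT F p t, ⁅X, TH a⁆ = TH b) :
    restrictHO F p t (LieAlgebra.ad F (Module.End F (O F n)) X) ∈ derHO F p t := by
  have hm : ∀ E : HOeven F p t, ⁅X, (E : Module.End F (O F n))⁆ ∈ HOeven F p t := by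
    intro E
    obtain ⟨a, ha, e⟩ := exists_oddOT_of_mem E.2
    obtain ⟨b, hb, e'⟩ := hX a ha
    rw [← e, e']
    exact TH_mem_HOeven hb
  refine ⟨⟨LinearMap.codRestrict (HOeven F p t).toSubmodule
    (restrictHO F p t (LieAlgebra.ad F (Module.End F (O F n)) X)) hm, fun D E => ?_⟩, fun E => rfl⟩
  apply Subtype.ext
  exact lie_lie_eq_sub X (D : Module.End F (O F n)) E

lemma restrictHO_ad_TH_add (z : O F n) (c : F) {a : O F n} (hz : z ∈ oddOT F p t)
    (ha : a ∈ oddOT F p t) :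
    restrictHO F p t (LieAlgebra.ad F (Module.End F (O F n)) (TH z + c • Gam F n))
      ⟨TH a, TH_mem_HOeven ha⟩ = TH (TH z a + c • (Gam F n a - a)) := by
  rw [restrictHO_apply, map_add, map_smul, LinearMap.add_apply, LinearMap.smul_apply,
    LieAlgebra.ad_apply, LieAlgebra.ad_apply, TH_bracket hz.2 ha.2, lie_Gam_TH ha.2, map_add,
    map_smul]

lemma mem_adHOGam {ψ : HOeven F p t →ₗ[F] Module.End F (O F n)} :
    ψ ∈ adHOGam F p t ↔ ∃ z ∈ oddOT F p t, ∃ c : F,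
      ψ = restrictHO F p t (LieAlgebra.ad F (Module.End F (O F n)) (TH z + c • Gam F n)) := by
  constructor
  · rintro ⟨X, hX, rfl⟩
    obtain ⟨D, hD, G, hG, rfl⟩ := Submodule.mem_sup.1 hX
    obtain ⟨z, hz, rfl⟩ := exists_oddOT_of_mem hD
    obtain ⟨c, rfl⟩ := Submodule.mem_span_singleton.1 hG
    exact ⟨z, hz, c, rfl⟩
  · rintro ⟨z, hz, c, rfl⟩
    exact ⟨_, Submodule.add_mem_sup (TH_mem_HOeven hz)
      (Submodule.smul_mem _ c (Submodule.mem_span_singleton_self _)), rfl⟩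

/-- The combination of the `(ad ∂_i)^{p^k}` with coefficients `d`. -/
noncomputable def adDelPowers (F : Type*) [Field F] (p : ℕ) [Fact p.Prime] [CharP F p]
    (t : Fin n → ℕ) (d : Fin n → ℕ → F) : HOeven F p t →ₗ[F] Module.End F (O F n) :=
  ∑ i, ∑ k ∈ Finset.Ico 1 (t i), d i k •
    restrictHO F p t (LieAlgebra.ad F (Module.End F (O F n)) (del (.inl i)) ^ p ^ k)

lemma adDelPowers_TH (d : Fin n → ℕ → F) {a : O F n} (ha : a ∈ oddOT F p t) :
    adDelPowers F p t d ⟨TH a, TH_mem_HOeven ha⟩ = TH (delPowers F p t d a) := by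
  simp only [adDelPowers, LinearMap.sum_apply, LinearMap.smul_apply, restrictHO_apply,
    ad_del_pow_TH ha.2, delPowers_apply, map_sum, map_smul]

lemma mem_adPowers {ψ : HOeven F p t →ₗ[F] Module.End F (O F n)} :
    ψ ∈ adPowers F p t ↔ ∃ d, ψ = adDelPowers F p t d := by
  classical
  constructor
  · intro h
    induction h using Submodule.span_induction with
    | mem x hx =>
      obtain ⟨i, k, hk, hkt, rfl⟩ := hx
      refine ⟨fun j l => if j = i ∧ l = k then 1 else 0, ?_⟩
      rw [adDelPowers, Finset.sum_eq_single i, Finset.sum_eq_single k]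
      · simp
      · intro l _ hl
        simp [hl]
      · intro h
        exact absurd (Finset.mem_Ico.2 ⟨hk, hkt⟩) h
      · intro j _ hj
        simp [hj]
      · simp
    | zero => exact ⟨0, by simp [adDelPowers]⟩
    | add x y _ _ hx hy =>
      obtain ⟨d, rfl⟩ := hx
      obtain ⟨d', rfl⟩ := hy
      exact ⟨d + d', by simp [adDelPowers, add_smul, Finset.sum_add_distrib]⟩
    | smul c x _ hx =>
      obtain ⟨d, rfl⟩ := hx
      exact ⟨c • d, by simp [adDelPowers, mul_smul, Finset.smul_sum]⟩
  · rintro ⟨d, rfl⟩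
    refine Submodule.sum_mem _ fun i _ => Submodule.sum_mem _ fun k hk => ?_
    rw [Finset.mem_Ico] at hk
    exact Submodule.smul_mem _ _ (Submodule.subset_span ⟨i, k, hk.1, hk.2, rfl⟩)

lemma ext_TH {ψ χ : HOeven F p t →ₗ[F] Module.End F (O F n)}
    (h : ∀ a (ha : a ∈ oddOT F p t),
      ψ ⟨TH a, TH_mem_HOeven ha⟩ = χ ⟨TH a, TH_mem_HOeven ha⟩) : ψ = χ := by
  refine LinearMap.ext fun E => ?_
  obtain ⟨D, hD⟩ := E
  obtain ⟨a, ha, rfl⟩ := exists_oddOT_of_mem hD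
  exact h a ha

lemma adHOGam_le_derHO : adHOGam F p t ≤ derHO F p t := by
  intro ψ hψ
  obtain ⟨z, hz, c, rfl⟩ := mem_adHOGam.1 hψ
  exact restrictHO_ad_mem_derHO fun a ha => ⟨_,
    add_mem (TH_mem_oddOT hz ha) (Submodule.smul_mem _ c (sub_mem (Gam_mem_oddOT ha) ha)),
    restrictHO_ad_TH_add z c hz ha⟩

/-- Each generator equals `ad (∂_i^{p^k})` in characteristic `p`, and `∂_i^{p^k}` normalizes `𝓗𝓞`.
-/
lemma adPowers_le_derHO : adPowers F p t ≤ derHO F p t := by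
  refine Submodule.span_le.2 ?_
  rintro _ ⟨i, k, -, -, rfl⟩
  rw [SetLike.mem_coe, ad_pow_char_pow]
  refine restrictHO_ad_mem_derHO fun a ha => ⟨_, del_inl_pow_mem_oddOT i (p ^ k) ha, ?_⟩
  rw [← ad_del_pow_TH ha.2, ad_pow_char_pow]
  rfl

lemma derHO_le (h3 : 3 < p) (hn : 3 ≤ n) (ht : ∀ i, 1 ≤ t i) :
    derHO F p t ≤ adHOGam F p t ⊔ adPowers F p t := by
  rintro ψ ⟨φ, hφ⟩
  obtain ⟨Φ, hΦ, hval⟩ := exists_isDer ht φ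
  obtain ⟨z, hz, c, d, he⟩ := hΦ.exists_eq h3 hn ht
  have : ψ = restrictHO F p t (LieAlgebra.ad F (Module.End F (O F n)) (TH z + c • Gam F n)) +
      adDelPowers F p t d := by
    refine ext_TH fun a ha => ?_
    rw [hφ, hval a ha, he a ha, LinearMap.add_apply, restrictHO_ad_TH_add z c hz ha,
      adDelPowers_TH d ha, map_add]
  rw [this]
  exact Submodule.add_mem_sup (mem_adHOGam.2 ⟨z, hz, c, rfl⟩) (mem_adPowers.2 ⟨d, rfl⟩)

/-- On elements `a` linear in the odd variables `Γ a - a = 0`, so there the inner part is compared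
with the powers alone. The powers kill `x_{i'}` and `x_i x_{i'}`, hence `z` commutes with both
families and is zero. Evaluation at `x_i^(p^k) x_{i'}` then gives `d i k = 0`. -/
lemma disjoint_adHOGam_adPowers (ht : ∀ i, 1 ≤ t i) :
    Disjoint (adHOGam F p t) (adPowers F p t) := by
  rw [Submodule.disjoint_def]
  intro ψ h₁ h₂
  obtain ⟨z, hz, c, e₁⟩ := mem_adHOGam.1 h₁
  obtain ⟨d, e₂⟩ := mem_adPowers.1 h₂
  have key : ∀ a ∈ oddOT F p t, TH z a + c • (Gam F n a - a) = delPowers F p t d a := by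
    intro a ha
    refine TH_injOn ht (add_mem (TH_mem_oddOT hz ha)
      (Submodule.smul_mem _ c (sub_mem (Gam_mem_oddOT ha) ha))) ((IsDer.delPowers d).mem a ha) ?_
    rw [← restrictHO_ad_TH_add z c hz ha, ← adDelPowers_TH d ha, ← e₁, ← e₂]
  have hlin : ∀ α : Fin n → ℕ, (∀ i, α i < p ^ t i) → ∀ j,
      - TH (mono α {j}) z = delPowers F p t d (mono α {j}) := by
    intro α hα j
    rw [← key _ (mono_single_mem hα j), Gam_mono, TH_antisymm hz.2 (mono_singleton_mem α j)]
    simp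
  have hz0 : z = 0 := by
    refine eq_zero_of_del_of_torus hz.2 (fun i => ?_) fun i => ?_
    · have := hlin 0 zero_lt_bound i
      rwa [delPowers_mono_eq_zero _ (by simp), TH_mono_zero, neg_neg] at this
    · have := hlin _ (single_lt_bound (hp.out.one_lt.trans_le (le_bound ht i))) i
      rwa [delPowers_mono_eq_zero, neg_eq_zero] at this
      intro k
      by_cases hk : k = i
      · subst hk
        simp
      · simp [hk]
  have hd : ∀ i, ∀ k ∈ Finset.Ico 1 (t i), d i k = 0 := by
    intro i k hk
    rw [Finset.mem_Ico] at hk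
    have := hlin _ (single_lt_bound (Nat.pow_lt_pow_right hp.out.one_lt hk.2)) i
    rw [← delPowers_mono_single (p := p) d hk.1 hk.2 {i}, ← this, hz0, map_zero, neg_zero]
    rfl
  rw [e₂, adDelPowers]
  refine Finset.sum_eq_zero fun i _ => Finset.sum_eq_zero fun k hk => ?_
  rw [hd i k hk, zero_smul]

end

end OddHamiltonian

theorem mainTheorem1 (F : Type*) [Field F] (p : ℕ) [Fact p.Prime] [CharP F p] (hp : 3 < p)
    (n : ℕ) (hn : 3 ≤ n) (t : Fin n → ℕ) (ht : ∀ i, 1 ≤ t i) :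
    OddHamiltonian.derHO F p t = OddHamiltonian.adHOGam F p t ⊔ OddHamiltonian.adPowers F p t ∧
      Disjoint (OddHamiltonian.adHOGam F p t) (OddHamiltonian.adPowers F p t) :=
  ⟨le_antisymm (OddHamiltonian.derHO_le hp hn ht)
    (sup_le OddHamiltonian.adHOGam_le_derHO OddHamiltonian.adPowers_le_derHO),
    OddHamiltonian.disjoint_adHOGam_adPowers ht⟩
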